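/- Let $E$ be a field, let $\tilde K=\bigcup_{n\ge 1}E((t^{-1/n}))$ be the Puiseux field with the valuation $\nu$ normalised by $\nu(t^{-1})=1$, let $\hat K$ be its completion, and let $\bar A\subset\hat K$ be the ring of Puiseux polynomials, i.e. of finite sums $\sum a_it^{r_i}$ with $a_i\in E$, $r_i\in\mathbb{Q}_{\ge 0}$. Put $\deg f=-\nu(f)$. An *expression* is a finite (possibly empty) or infinite sequence $\varpi=[f_0,f_1,\dots]$ in $\bar A$ with $\deg f_i>0$ for all $i>0$. The value of a nonempty finite expression is $[f_0,\dots,f_n]_{\mathrm{ev}}=f_0+\frac{1}{f_1+\frac{1}{\ddots+\frac1{f_n}}}$, and the value of an infinite one is the limit in $\hat K$ of the values of its truncations, when this limit exists. For a finite expression $\varpi$ let $B_\varpi\subseteq\hat K$ be the set of the values of all nonempty expressions that start with $\varpi$ (i.e. of the elements whose continued fraction starts with $\varpi$). For a set $D\subseteq\hat K$ let $B_{\varpi-D}$ be the set of the values of all expressions that start with $[\varpi,h]$ for some $h\in D\cap\bar A$ with $\deg h>0$. For $a\in\hat K$ and $r\in\mathbb{R}$, the open (closed) ball with centre $a$ and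 parameter $r$ is $\{b:\nu(b-a)>r\}$ (resp. $\{b:\nu(b-a)\ge r\}$). Let $|z|=e^{-\nu(z)}$. The Berkovich affine line over $\hat K$ is the space of the multiplicative seminorms on $\hat K[X]$ that extend $|\cdot|$, with the topology of pointwise convergence, and $\mathbb{P}^{1,\mathrm{Berk}}$ is its one-point compactification. The point $\eta_{a,r}$ that corresponds to the open or closed ball with centre $a$ and parameter $r$ is the seminorm $\sum_i c_i(X-a)^i\mapsto\max_i|c_i|e^{-ri}$. A sequence of balls converges to $\eta\in\mathbb{P}^{1,\mathrm{Berk}}$ if the corresponding points do. A point $\eta\neq\infty$ has *type IV* if it is the limit of a decreasing sequence $B_1\supseteq B_2\supseteq\cdots$ of closed balls with empty intersection; in that case $\eta$ *lies in* a set $S\subseteq\hat K$ if such a sequence can be chosen with $B_n\subseteq S$ for some $n$. A point $\eta$ of type IV has *type IVa* if there is an infinite expression $[f_0,f_1,\dots]$ with $\sum_{i\ge1}\deg f_i<\infty$ for which the sets $B_{[f_0,\dots,f_n]}$ are balls that converge to $\eta$ as $n\to\infty$; otherwise it has *type IVb*. **Theorem.** 1. For every finite nonempty expression $\varpi=[f_0,\dots,f_n]$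 the set $B_\varpi$ is a ball, namely the open ball with centre $\varpi_{\mathrm{ev}}$ and parameter $2\sum_{i=1}^n\deg f_i$. 2. Let $[f_0,f_1,\dots]$ be an infinite expression for which $\sum_{i\ge1}\deg f_i$ converges, and let $\varpi_n=[f_0,\dots,f_n]$. Then $B_{\varpi_0}\supseteq B_{\varpi_1}\supseteq\cdots$, $\bigcap_nB_{\varpi_n}=\varnothing$, and the balls $B_{\varpi_n}$ converge to a point of type IV. 3. Not every point of type IV arises as in (2): there are points of type IVb. 4. Let $\eta$ be a point of type IVb. Then there is a longest finite (possibly empty) expression $\varpi$ such that $\eta$ lies in $B_\varpi$: every finite expression $\varpi'$ such that $\eta$ lies in $B_{\varpi'}$ is an initial segment of $\varpi$. Moreover, there are closed balls $D_1\supseteq D_2\supseteq\cdots$ with negative parameters and empty intersection such that the sets $B_{\varpi-D_n}$ are balls and converge to $\eta$. -/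

import Mathlib

open Filter Topology

noncomputable section

namespace PuiseuxCF

/-! ### The Puiseux field, its valuation and its completion

Everything is written inside the field `HahnSeries ℚ E`; its element `single q a` stands for
the monomial `a * t ^ (-q)`, so that `t⁻¹` has order `1`. -/

section PuiseuxField

variable (E : Type*) [Field E]

/-- The order embedding `k ↦ k / n` of `ℤ` into `ℚ`, as a homomorphism of groups. -/
def divHom (n : ℕ+) : ℤ →+ ℚ := (AddMonoidHom.mulRight ((n : ℚ)⁻¹)).comp (Int.castAddHom ℚ)

theorem divHom_apply (n : ℕ+) (k : ℤ) : divHom n k = (k : ℚ) / (n : ℚ) := rfl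

theorem divHom_le (n : ℕ+) (a b : ℤ) : divHom n a ≤ divHom n b ↔ a ≤ b := by
  have hn : (0 : ℚ) < (n : ℚ) := by exact_mod_cast n.pos
  rw [divHom_apply, divHom_apply, div_le_div_iff_of_pos_right hn, Int.cast_le]

theorem divHom_injective (n : ℕ+) : Function.Injective (divHom n) := fun a b h =>
  le_antisymm ((divHom_le n a b).1 h.le) ((divHom_le n b a).1 h.ge)

/-- The embedding `E((t^(-1/n))) → HahnSeries ℚ E`: the Laurent series `∑ aᵢ Xⁱ` goes to
`∑ aᵢ t^(-i/n)`. -/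
def laurentEmb (n : ℕ+) : LaurentSeries E →+* HahnSeries ℚ E :=
  HahnSeries.embDomainRingHom (divHom n) (divHom_injective n) (divHom_le n)

theorem coeff_laurentEmb (n : ℕ+) (x : LaurentSeries E) (k : ℤ) :
    (laurentEmb E n x).coeff ((k : ℚ) / (n : ℚ)) = x.coeff k :=
  HahnSeries.embDomain_mk_coeff (f := divHom n) (divHom_injective n) (divHom_le n)

theorem coeff_laurentEmb_of_ne (n : ℕ+) (x : LaurentSeries E) (q : ℚ)
    (hq : ∀ k : ℤ, (k : ℚ) / (n : ℚ) ≠ q) : (laurentEmb E n x).coeff q = 0 :=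
  HahnSeries.embDomain_of_notMem_range (by rintro ⟨k, hk⟩; exact hq k hk)

/-- The field `K_n = E((t^(-1/n)))`. -/
def laurentSubfield (n : ℕ+) : Subfield (HahnSeries ℚ E) := (laurentEmb E n).fieldRange

/-- The Puiseux field `E⟨⟨t⁻¹⟩⟩`, the union of all the `E((t^(-1/n)))`. -/
def puiseuxSubfield : Subfield (HahnSeries ℚ E) := ⨆ n : ℕ+, laurentSubfield E n

theorem laurentSubfield_le_mul (m n : ℕ+) : laurentSubfield E m ≤ laurentSubfield E (m * n) := by
  rintro _ ⟨x, rfl⟩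
  have hn : 0 < ((n : ℕ) : ℤ) := by exact_mod_cast n.pos
  have hm : (m : ℚ) ≠ 0 := by exact_mod_cast m.ne_zero
  have hnq : (n : ℚ) ≠ 0 := by exact_mod_cast n.ne_zero
  let g : ℤ ↪o ℤ := OrderEmbedding.ofMapLEIff (fun k => k * ((n : ℕ) : ℤ))
    (fun a b => mul_le_mul_iff_left₀ hn)
  refine ⟨HahnSeries.embDomain g x, ?_⟩
  have e1 : ∀ k : ℤ, (k : ℚ) / (m : ℚ) = ((g k : ℤ) : ℚ) / ((m * n : ℕ+) : ℚ) := by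
    intro k
    change _ = ((k * ((n : ℕ) : ℤ) : ℤ) : ℚ) / _
    push_cast
    field_simp
  ext q
  by_cases hq : ∃ k : ℤ, (k : ℚ) / (m : ℚ) = q
  · obtain ⟨k, rfl⟩ := hq
    rw [coeff_laurentEmb, e1, coeff_laurentEmb, HahnSeries.embDomain_coeff]
  · push Not at hq
    rw [coeff_laurentEmb_of_ne E m x q hq]
    by_cases hq' : ∃ k : ℤ, (k : ℚ) / ((m * n : ℕ+) : ℚ) = q
    · obtain ⟨k, rfl⟩ := hq'
      rw [coeff_laurentEmb]
      refine HahnSeries.embDomain_of_notMem_range ?_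
      rintro ⟨j, rfl⟩
      exact hq j (e1 j)
    · push Not at hq'
      exact coeff_laurentEmb_of_ne E _ _ q hq'

theorem mem_puiseuxSubfield (x : HahnSeries ℚ E) :
    x ∈ puiseuxSubfield E ↔ ∃ n : ℕ+, ∃ y : LaurentSeries E, laurentEmb E n y = x := by
  have hd : Directed (· ≤ ·) (laurentSubfield E) := fun m n =>
    ⟨m * n, laurentSubfield_le_mul E m n, by
      rw [mul_comm]; exact laurentSubfield_le_mul E n m⟩
  rw [puiseuxSubfield, Subfield.mem_iSup_of_directed hd]
  rfl

/-- The absolute value `|x| = exp (-ν x)` on Hahn series, `ν x` being the smallest exponent of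
`t⁻¹` in `x`. -/
def hahnAbs : AbsoluteValue (HahnSeries ℚ E) ℝ where
  toFun x := open Classical in if x = 0 then 0 else Real.exp (-(x.order : ℝ))
  map_mul' x y := by
    by_cases hx : x = 0
    · simp [hx]
    by_cases hy : y = 0
    · simp [hy]
    simp only [hx, hy, mul_eq_zero, or_self, if_false]
    rw [HahnSeries.order_mul hx hy, ← Real.exp_add]
    push_cast
    ring_nf
  nonneg' x := by split_ifs <;> positivity
  eq_zero' x := by
    by_cases hx : x = 0
    · simp [hx]
    · simp [hx, (Real.exp_pos _).ne']
  add_le' x y := by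
    by_cases hx : x = 0
    · subst hx
      rw [zero_add, if_pos (rfl : (0 : HahnSeries ℚ E) = 0), zero_add]
    by_cases hy : y = 0
    · subst hy
      rw [add_zero, if_pos (rfl : (0 : HahnSeries ℚ E) = 0), add_zero]
    by_cases hxy : x + y = 0
    · simp only [hxy, if_true]
      split_ifs <;> positivity
    simp only [hx, hy, hxy, if_false]
    have h : min x.order y.order ≤ (x + y).order := HahnSeries.min_order_le_order_add hxy
    rcases min_le_iff.1 h with h | h
    · have : Real.exp (-((x + y).order : ℝ)) ≤ Real.exp (-(x.order : ℝ)) :=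
        Real.exp_le_exp.2 (neg_le_neg (by exact_mod_cast h))
      linarith [Real.exp_pos (-(y.order : ℝ))]
    · have : Real.exp (-((x + y).order : ℝ)) ≤ Real.exp (-(y.order : ℝ)) :=
        Real.exp_le_exp.2 (neg_le_neg (by exact_mod_cast h))
      linarith [Real.exp_pos (-(x.order : ℝ))]

theorem hahnAbs_of_ne {x : HahnSeries ℚ E} (hx : x ≠ 0) :
    hahnAbs E x = Real.exp (-(x.order : ℝ)) := if_neg hx

theorem hahnAbs_add_le_max (x y : HahnSeries ℚ E) :
    hahnAbs E (x + y) ≤ max (hahnAbs E x) (hahnAbs E y) := by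
  by_cases hx : x = 0
  · simp [hx]
  by_cases hy : y = 0
  · simp [hy]
  by_cases hxy : x + y = 0
  · rw [hxy, map_zero]
    exact le_max_of_le_left ((hahnAbs E).nonneg x)
  have h : min x.order y.order ≤ (x + y).order := HahnSeries.min_order_le_order_add hxy
  rw [hahnAbs_of_ne E hx, hahnAbs_of_ne E hy, hahnAbs_of_ne E hxy]
  rcases min_le_iff.1 h with h | h
  · exact le_max_of_le_left (Real.exp_le_exp.2 (neg_le_neg (by exact_mod_cast h)))
  · exact le_max_of_le_right (Real.exp_le_exp.2 (neg_le_neg (by exact_mod_cast h)))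

/-- The Puiseux field as a type. -/
abbrev Puiseux : Type _ := puiseuxSubfield E

instance : NormedField (Puiseux E) :=
  ((hahnAbs E).comp (f := (puiseuxSubfield E).subtype)
    Subtype.val_injective).toNormedField

theorem norm_puiseux (x : Puiseux E) : ‖x‖ = hahnAbs E (x : HahnSeries ℚ E) := rfl

instance : IsUltrametricDist (Puiseux E) :=
  IsUltrametricDist.isUltrametricDist_of_forall_norm_add_le_max_norm
    fun x y => hahnAbs_add_le_max E x y

/-- The completion `K̂` of the Puiseux field. It carries the norm `‖z‖ = exp (-ν z)`. -/
abbrev Khat : Type _ := UniformSpace.Completion (Puiseux E)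

instance : IsUltrametricDist (Khat E) :=
  IsUltrametricDist.isUltrametricDist_of_forall_norm_add_le_max_norm fun x y => by
    induction x, y using UniformSpace.Completion.induction_on₂ with
    | hp =>
      exact isClosed_le (continuous_norm.comp (continuous_fst.add continuous_snd))
        ((continuous_norm.comp continuous_fst).max (continuous_norm.comp continuous_snd))
    | ih x y =>
      rw [← UniformSpace.Completion.coe_add]
      simp only [UniformSpace.Completion.norm_coe]
      exact IsUltrametricDist.norm_add_le_max x y

variable {E}

/-- The valuation `ν` of `K̂`, with `ν 0 = ⊤`. -/
def val (z : Khat E) : WithTop ℝ :=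
  open Classical in if z = 0 then ⊤ else ((-Real.log ‖z‖ : ℝ) : WithTop ℝ)

/-- The degree `deg f = -ν f` of `f ≠ 0`. (For `f = 0` this is `0` instead of `-∞`; below it is
only used through the condition `0 < deg f` and for `f` satisfying it.) -/
def deg (f : Khat E) : ℝ := -(val f).untopD 0

variable (E) in
/-- The Puiseux polynomials as a subring of the Puiseux field: finite sums of monomials
`a * t ^ r` with `0 ≤ r` rational, i.e. series with finite support contained in the set of
nonpositive exponents of `t⁻¹`. -/
def puiseuxPolySubring : Subring (Puiseux E) where
  carrier := {x | (x : HahnSeries ℚ E).support.Finite ∧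
    ∀ q ∈ (x : HahnSeries ℚ E).support, q ≤ 0}
  mul_mem' := by
    rintro x y ⟨hx, hx'⟩ ⟨hy, hy'⟩
    refine ⟨(hx.add hy).subset HahnSeries.support_mul_subset, fun q hq => ?_⟩
    obtain ⟨a, ha, b, hb, rfl⟩ := HahnSeries.support_mul_subset hq
    exact add_nonpos (hx' a ha) (hy' b hb)
  one_mem' := by
    have h : (HahnSeries.support ((1 : Puiseux E) : HahnSeries ℚ E)) ⊆ {0} :=
      HahnSeries.support_single_subset
    exact ⟨(Set.finite_singleton 0).subset h, fun q hq => (h hq).le⟩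
  add_mem' := by
    rintro x y ⟨hx, hx'⟩ ⟨hy, hy'⟩
    have h : (HahnSeries.support ((x + y : Puiseux E) : HahnSeries ℚ E)) ⊆
        HahnSeries.support (x : HahnSeries ℚ E) ∪ HahnSeries.support (y : HahnSeries ℚ E) :=
      HahnSeries.support_add_subset _ _
    exact ⟨(hx.union hy).subset h, fun q hq => (h hq).elim (hx' q) (hy' q)⟩
  zero_mem' := by simp
  neg_mem' := by
    rintro x ⟨hx, hx'⟩
    have h : (HahnSeries.support ((-x : Puiseux E) : HahnSeries ℚ E)) =
      HahnSeries.support (x : HahnSeries ℚ E) := HahnSeries.support_neg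
    exact ⟨h ▸ hx, fun q hq => hx' q (h ▸ hq)⟩

variable (E) in
/-- The ring `Ā = E⟨t⟩` of Puiseux polynomials, inside `K̂`. -/
def puiseuxPoly : Subring (Khat E) :=
  (puiseuxPolySubring E).map (UniformSpace.Completion.coeRingHom : Puiseux E →+* Khat E)

/-- The open ball `{b | ν (b - a) > r}`. -/
def openBall (a : Khat E) (r : ℝ) : Set (Khat E) := {b | (r : WithTop ℝ) < val (b - a)}

/-- The closed ball `{b | ν (b - a) ≥ r}`. -/
def closedBall (a : Khat E) (r : ℝ) : Set (Khat E) := {b | (r : WithTop ℝ) ≤ val (b - a)}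

end PuiseuxField

/-! ### Continued fractions -/

section ContinuedFractions

variable {E : Type*} [Field E]

/-- The value `f₀ + 1 / (f₁ + 1 / (⋯ + 1 / fₙ))` of the finite expression `[f₀, …, fₙ]`. -/
def eval : List (Khat E) → Khat E
  | [] => 0
  | [f] => f
  | f :: g :: l => f + (eval (g :: l))⁻¹

/-- The truncation `[f₀, …, fₙ]` of a sequence. -/
def trunc (f : ℕ → Khat E) (n : ℕ) : List (Khat E) := (List.range (n + 1)).map f

/-- Finite (possibly empty) expressions `[f₀, …, fₙ]`: the `fᵢ` are Puiseux polynomials, of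
positive degree for `i > 0`. -/
def IsExpr (l : List (Khat E)) : Prop :=
  (∀ f ∈ l, f ∈ puiseuxPoly E) ∧ ∀ f ∈ l.tail, 0 < deg f

/-- Infinite expressions `[f₀, f₁, …]`: the `fᵢ` are Puiseux polynomials, of positive degree
for `i > 0`. -/
def IsInfExpr (f : ℕ → Khat E) : Prop :=
  (∀ i, f i ∈ puiseuxPoly E) ∧ ∀ i, 0 < i → 0 < deg (f i)

/-- `HasExprStarting l z`: the element `z` is the value of a finite expression, or of a
convergent infinite one, that starts with the terms of `l`. -/
def HasExprStarting (l : List (Khat E)) (z : Khat E) : Prop :=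
  (∃ l' : List (Khat E), l' ≠ [] ∧ IsExpr l' ∧ l <+: l' ∧ eval l' = z) ∨
  (∃ f : ℕ → Khat E, IsInfExpr f ∧ (∃ n, l <+: trunc f n) ∧
    Tendsto (fun n => eval (trunc f n)) atTop (𝓝 z))

/-- The set `B_ϖ` of the elements of `K̂` whose continued fraction starts with `ϖ`. -/
def ballOf (l : List (Khat E)) : Set (Khat E) := {z | HasExprStarting l z}

/-- The set `B_{ϖ-D}` of the elements of `K̂` whose continued fraction starts with `ϖ`,
followed by a coefficient in `D` of positive degree. -/
def ballOfUndef (l : List (Khat E)) (D : Set (Khat E)) : Set (Khat E) :=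
  {z | ∃ h ∈ D, h ∈ puiseuxPoly E ∧ 0 < deg h ∧ HasExprStarting (l ++ [h]) z}

end ContinuedFractions

/-! ### The Berkovich projective line -/

section Berkovich

open Polynomial

/-- The Berkovich affine line over a normed field `K`: the multiplicative seminorms on `K[X]`
that extend the norm of `K`. -/
def BerkovichA1 (K : Type*) [NormedField K] : Type _ :=
  {x : MulRingSeminorm K[X] // ∀ c : K, x (C c) = ‖c‖}

/-- The topology of pointwise convergence. -/
instance (K : Type*) [NormedField K] : TopologicalSpace (BerkovichA1 K) :=
  TopologicalSpace.induced (fun x (f : K[X]) => x.1 f) inferInstance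

/-- The Berkovich projective line, the one-point compactification of the affine one. -/
abbrev BerkovichP1 (K : Type*) [NormedField K] : Type _ := OnePoint (BerkovichA1 K)

variable {E : Type*} [Field E]

/-- The point `η_{a,r}` of the Berkovich line given by the closed ball `{b | ν (b - a) ≥ r}`: the
seminorm `∑ cᵢ (X - a)ⁱ ↦ max |cᵢ| exp (-r)ⁱ`. -/
def ballPointA1 (a : Khat E) (r : ℝ) : BerkovichA1 (Khat E) :=
  have hna : IsNonarchimedean (NormedField.toAbsoluteValue (Khat E)) :=
    fun x y => IsUltrametricDist.norm_add_le_max x y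
  have hc : 0 < Real.exp (-r) := Real.exp_pos _
  ⟨{ toFun := fun f =>
      (taylor a f).gaussNorm (NormedField.toAbsoluteValue (Khat E)) (Real.exp (-r))
     map_zero' := by simp
     map_one' := by
       rw [taylor_one, gaussNorm_C, map_one]
     map_mul' := fun f g => by rw [taylor_mul, gaussNorm_mul hna hc]
     add_le' := fun f g => by
       rw [map_add]
       have h := isNonarchimedean_gaussNorm (NormedField.toAbsoluteValue (Khat E)) hna hc.le
         (taylor a f) (taylor a g)
       refine h.trans (max_le_add_of_nonneg ?_ ?_) <;> exact gaussNorm_nonneg _ _ hc.le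
     neg' := fun f => by
       rw [map_neg]
       simp only [gaussNorm, support_neg, coeff_neg, AbsoluteValue.map_neg] },
    fun c => by
      change (taylor a (C c)).gaussNorm _ _ = _
      rw [taylor_C, gaussNorm_C]
      rfl⟩

/-- The point `η_{a,r}` in the Berkovich projective line. -/
def ballPoint (a : Khat E) (r : ℝ) : BerkovichP1 (Khat E) := (ballPointA1 a r : BerkovichA1 _)

/-- `IsPointOf S x`: the set `S` is an open or closed ball, and `x` is the corresponding point
of the Berkovich line. -/
def IsPointOf (S : Set (Khat E)) (x : BerkovichP1 (Khat E)) : Prop :=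
  ∃ a r, (S = openBall a r ∨ S = closedBall a r) ∧ x = ballPoint a r

/-- `BallsTendTo S η`: the `Sₙ` are balls and the corresponding points of the Berkovich line
converge to `η`. -/
def BallsTendTo (S : ℕ → Set (Khat E)) (η : BerkovichP1 (Khat E)) : Prop :=
  ∃ x : ℕ → BerkovichP1 (Khat E), (∀ n, IsPointOf (S n) (x n)) ∧ Tendsto x atTop (𝓝 η)

/-- `IsNest B`: the `Bₙ` form a decreasing sequence of closed balls with empty intersection. -/
def IsNest (B : ℕ → Set (Khat E)) : Prop :=
  (∀ n, ∃ a r, B n = closedBall a r) ∧ Antitone B ∧ ⋂ n, B n = ∅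

/-- Points of type IV: limits of the points of a decreasing sequence of closed balls with empty
intersection (they lie in the affine line, as `∞` is of type I). -/
def IsTypeIV (η : BerkovichP1 (Khat E)) : Prop :=
  η ≠ OnePoint.infty ∧ ∃ B, IsNest B ∧ BallsTendTo B η

/-- `LiesIn η S`, for a point `η` of type IV: the balls of a decreasing sequence with empty
intersection that defines `η` are eventually contained in `S`. -/
def LiesIn (η : BerkovichP1 (Khat E)) (S : Set (Khat E)) : Prop :=
  ∃ B, IsNest B ∧ BallsTendTo B η ∧ ∃ n, B n ⊆ S

/-- Points of type IVa: the points of type IV that are limits of the balls `B_{[f₀, …, fₙ]}` of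
an infinite expression with `∑ deg fᵢ` convergent. -/
def IsTypeIVa (η : BerkovichP1 (Khat E)) : Prop :=
  IsTypeIV η ∧ ∃ f : ℕ → Khat E, IsInfExpr f ∧ Summable (fun i => deg (f (i + 1))) ∧
    BallsTendTo (fun n => ballOf (trunc f n)) η

/-- Points of type IVb: the remaining points of type IV. -/
def IsTypeIVb (η : BerkovichP1 (Khat E)) : Prop := IsTypeIV η ∧ ¬ IsTypeIVa η

end Berkovich

end PuiseuxCF

end

/-! Write `phi l w` for the value of the expression `l` continued by a tail of value `w`, where `w`
is `0` (no tail) or has norm above `1`. In the coordinate `w⁻¹` the tails fill the open unit ball.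
Each inversion at a term `g` after the first divides distances by `‖g‖ ^ 2`, so `phi` maps the tails
onto an open ball of radius `rad` (`norm_phi_sub_phi`, `exists_phi_eq_of_norm_sub_lt`). Since a
Puiseux polynomial is determined by any element at distance less than `1`, expansions are unique,
and this image is `ballOf l` (`ballOf_eq_cell`).

If the degrees have bounded sum, a common point of the balls could be replaced by a nearby element
of some `E((t^(-1/N)))`. All terms would then lie in that field and have degree at least `1/N`,
which is absurd (`IsInfExpr.exists_notMem_cell`). Hence the intersection is empty and the limit has
type IV.

A point of type IVa is at distance at most `1` from a polynomial. The balls around the partial sums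
of `∑ t ^ (1 + 1/(k+1))` have radii above `e` and empty intersection because the denominators are
unbounded, so their limit has type IVb.

The expressions whose balls contain a type IV point form a chain. If the chain is infinite, either
the degrees are summable and the point has type IVa, or the balls shrink to an element `z` and the
seminorm kills `X - z`, which is impossible in type IV (`NestTo.isTypeIVa_of_forall_liesIn`). So
type IVb has a longest expression `l`. Pulling the nest back through `phi l` gives the balls `D_n`:
were some parameter nonnegative, a later ball would have radius below `1` and determine one more
term. -/

namespace PuiseuxCF

/-! ### Puiseux polynomials, the subfields `E((t^(-1/n)))`, and ultrametric estimates -/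

section Puiseux

variable {E : Type*} [Field E]

theorem openBall_eq_ball (a : Khat E) (r : ℝ) :
    openBall a r = Metric.ball a (Real.exp (-r)) := by
  ext b
  rw [openBall, Set.mem_ofPred_eq, mem_ball_iff_norm, val]
  split_ifs with h
  · simp [h, Real.exp_pos]
  · rw [WithTop.coe_lt_coe, lt_neg, Real.log_lt_iff_lt_exp (norm_pos_iff.2 h)]

theorem closedBall_eq_closedBall (a : Khat E) (r : ℝ) :
    closedBall a r = Metric.closedBall a (Real.exp (-r)) := by
  ext b
  rw [closedBall, Set.mem_ofPred_eq, mem_closedBall_iff_norm, val]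
  split_ifs with h
  · simp [h, (Real.exp_pos _).le]
  · rw [WithTop.coe_le_coe, le_neg, Real.log_le_iff_le_exp (norm_pos_iff.2 h)]

theorem deg_eq_log_norm (f : Khat E) : deg f = Real.log ‖f‖ := by
  rw [deg, val]
  split_ifs with h
  · simp [h]
  · change -(-Real.log ‖f‖) = _
    rw [neg_neg]

theorem deg_pos_iff {f : Khat E} : 0 < deg f ↔ 1 < ‖f‖ := by
  rw [deg_eq_log_norm, Real.log_pos_iff (norm_nonneg f)]

theorem coeff_eq_zero_of_hahnAbs_le {x : HahnSeries ℚ E} {r : ℝ}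
    (h : hahnAbs E x ≤ Real.exp (-r)) {q : ℚ} (hq : (q : ℝ) < r) : x.coeff q = 0 := by
  by_cases hx : x = 0
  · simp [hx]
  rw [hahnAbs_of_ne E hx, Real.exp_le_exp, neg_le_neg_iff] at h
  exact HahnSeries.coeff_eq_zero_of_lt_order (by exact_mod_cast hq.trans_le h)

theorem hahnAbs_lt_one_of_coeff {x : HahnSeries ℚ E} (h : ∀ q ≤ 0, x.coeff q = 0) :
    hahnAbs E x < 1 := by
  by_cases hx : x = 0
  · simp [hx]
  rw [hahnAbs_of_ne E hx, Real.exp_lt_one_iff, neg_lt_zero]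
  by_contra! hq
  exact HahnSeries.coeff_order_eq_zero.not.2 hx (h _ (by exact_mod_cast hq))

/-- The order of a nonzero polynomial is one of its exponents of `t⁻¹`, hence at most `0`. This
discreteness makes the terms of a continued fraction unique. -/
theorem eq_zero_of_mem_puiseuxPoly {p : Khat E} (hp : p ∈ puiseuxPoly E) (h : ‖p‖ < 1) :
    p = 0 := by
  obtain ⟨x, hx, rfl⟩ := hp
  change ‖(x : Khat E)‖ < 1 at h
  rw [UniformSpace.Completion.norm_coe, norm_puiseux] at h
  by_cases h0 : (x : HahnSeries ℚ E) = 0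
  · rw [Subtype.ext (a1 := x) (a2 := 0) h0, map_zero]
  rw [hahnAbs_of_ne E h0, Real.exp_lt_one_iff, neg_lt_zero] at h
  have h1 := hx.2 _ (HahnSeries.coeff_order_eq_zero.not.2 h0)
  exact absurd h (not_lt.2 (by exact_mod_cast h1))

theorem eq_of_mem_puiseuxPoly {p q : Khat E} (hp : p ∈ puiseuxPoly E) (hq : q ∈ puiseuxPoly E)
    (h : ‖p - q‖ < 1) : p = q :=
  sub_eq_zero.1 (eq_zero_of_mem_puiseuxPoly ((puiseuxPoly E).sub_mem hp hq) h)

variable (E) in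
/-- The field `E((t^(-1/n)))` inside `K̂`. -/
noncomputable def puiseuxLevel (n : ℕ+) : Subfield (Khat E) :=
  ((laurentSubfield E n).comap (puiseuxSubfield E).subtype).map
    (UniformSpace.Completion.coeRingHom : Puiseux E →+* Khat E)

theorem exists_mem_puiseuxLevel (x : Puiseux E) : ∃ n, (x : Khat E) ∈ puiseuxLevel E n := by
  obtain ⟨n, y, hy⟩ := (mem_puiseuxSubfield E _).1 x.2
  exact ⟨n, x, ⟨y, hy⟩, rfl⟩

theorem laurentSubfield_le_puiseuxSubfield (n : ℕ+) :
    laurentSubfield E n ≤ puiseuxSubfield E := le_iSup (laurentSubfield E) n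

/-- A Laurent series has finitely many nonpositive exponents, so its polynomial part is a finite
sum, and it stays at the same level `n`. -/
theorem exists_poly_of_mem_puiseuxLevel {n : ℕ+} {z : Khat E} (hz : z ∈ puiseuxLevel E n) :
    ∃ p ∈ puiseuxPoly E, p ∈ puiseuxLevel E n ∧ ‖z - p‖ < 1 := by
  obtain ⟨x, ⟨y, hy⟩, rfl⟩ := hz
  have hn : (0 : ℚ) < (n : ℚ) := by exact_mod_cast n.pos
  -- For integer exponents, being below `1` means being at most `0`: the constant term is kept.
  let p : LaurentSeries E := HahnSeries.truncLT (1 : ℤ) y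
  have hsub : (laurentEmb E n p).support ⊆ divHom n '' p.support := by
    intro q hq
    by_cases h : ∃ k : ℤ, (k : ℚ) / (n : ℚ) = q
    · obtain ⟨k, rfl⟩ := h
      rw [HahnSeries.mem_support, coeff_laurentEmb] at hq
      exact ⟨k, hq, rfl⟩
    · push Not at h
      exact absurd (coeff_laurentEmb_of_ne E n p q h) hq
  have hp0 : ∀ k ∈ p.support, k ≤ 0 := by
    intro k hk
    by_contra! h
    exact hk (HahnSeries.coeff_truncLT_of_le (by omega) y)
  let px : Puiseux E := ⟨laurentEmb E n p, laurentSubfield_le_puiseuxSubfield n ⟨p, rfl⟩⟩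
  refine ⟨(px : Khat E), ⟨px, ⟨?_, ?_⟩, rfl⟩, ⟨px, ⟨p, rfl⟩, rfl⟩, ?_⟩
  · refine (Set.Finite.image _ ?_).subset hsub
    refine (Set.finite_Icc y.order 0).subset fun k hk => ⟨?_, hp0 k hk⟩
    by_contra! h
    refine hk ?_
    rw [HahnSeries.coeff_truncLT, HahnSeries.coeff_eq_zero_of_lt_order h, ite_self]
  · intro q hq
    obtain ⟨k, hk, rfl⟩ := hsub hq
    rw [divHom_apply]
    exact div_nonpos_of_nonpos_of_nonneg (by exact_mod_cast hp0 k hk) hn.le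
  · change ‖(x : Khat E) - (px : Khat E)‖ < 1
    rw [← UniformSpace.Completion.coe_sub, UniformSpace.Completion.norm_coe, norm_puiseux]
    refine hahnAbs_lt_one_of_coeff fun q hq => ?_
    change ((x : HahnSeries ℚ E) - laurentEmb E n p).coeff q = 0
    have hy' : laurentEmb E n y = (x : HahnSeries ℚ E) := hy
    rw [← hy', ← map_sub]
    by_cases h : ∃ k : ℤ, (k : ℚ) / (n : ℚ) = q
    · obtain ⟨k, rfl⟩ := h
      have hk : (k : ℚ) ≤ 0 := by
        by_contra! h
        exact absurd hq (not_le.2 (div_pos h hn))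
      rw [coeff_laurentEmb, HahnSeries.coeff_sub, sub_eq_zero]
      have hk' : k ≤ 0 := by exact_mod_cast hk
      exact (HahnSeries.coeff_truncLT_of_lt (by omega) y).symm
    · push Not at h
      exact coeff_laurentEmb_of_ne E n _ q h

theorem exists_puiseux_norm_sub_lt (z : Khat E) {ε : ℝ} (hε : 0 < ε) :
    ∃ x : Puiseux E, ‖z - x‖ < ε := by
  obtain ⟨x, h⟩ := (UniformSpace.Completion.denseRange_coe (α := Puiseux E)).exists_mem_open
    Metric.isOpen_ball ⟨z, Metric.mem_ball_self hε⟩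
  exact ⟨x, by rwa [Metric.mem_ball', dist_eq_norm] at h⟩

theorem norm_sub_lt_of_lt {K : Type*} [NormedField K] [IsUltrametricDist K] {a b c : K} {r : ℝ}
    (h : ‖a - b‖ < r) (h' : ‖b - c‖ < r) : ‖a - c‖ < r := by
  rw [← sub_add_sub_cancel a b c]
  exact (IsUltrametricDist.norm_add_le_max _ _).trans_lt (max_lt h h')

theorem norm_sub_le_of_le {K : Type*} [NormedField K] [IsUltrametricDist K] {a b c : K} {r : ℝ}
    (h : ‖a - b‖ ≤ r) (h' : ‖b - c‖ ≤ r) : ‖a - c‖ ≤ r := by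
  rw [← sub_add_sub_cancel a b c]
  exact (IsUltrametricDist.norm_add_le_max _ _).trans (max_le h h')

theorem norm_eq_of_norm_sub_lt {K : Type*} [NormedField K] [IsUltrametricDist K] {a b : K}
    (h : ‖a - b‖ < ‖a‖) : ‖b‖ = ‖a‖ := by
  have h1 : ‖b‖ ≤ ‖a‖ := by
    have := norm_sub_le_of_le (a := b) (b := a) (c := 0) (norm_sub_rev a b ▸ h.le)
      (by rw [sub_zero])
    rwa [sub_zero] at this
  refine h1.antisymm ?_
  by_contra! h2
  have := norm_sub_lt_of_lt (a := a) (b := b) (c := 0) h (by rwa [sub_zero])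
  rw [sub_zero] at this
  exact lt_irrefl _ this

theorem exists_poly (z : Khat E) : ∃ p ∈ puiseuxPoly E, ‖z - p‖ < 1 := by
  obtain ⟨x, hx⟩ := exists_puiseux_norm_sub_lt z one_pos
  obtain ⟨n, hn⟩ := exists_mem_puiseuxLevel x
  obtain ⟨p, hp, -, h⟩ := exists_poly_of_mem_puiseuxLevel hn
  exact ⟨p, hp, norm_sub_lt_of_lt hx h⟩

/-- At level `n` the valuation takes values in `(1/n)ℤ`, so a positive degree is at least `1/n`. -/
theorem le_norm_of_mem_puiseuxLevel {n : ℕ+} {z : Khat E} (hz : z ∈ puiseuxLevel E n)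
    (h : 1 < ‖z‖) : Real.exp (1 / (n : ℝ)) ≤ ‖z‖ := by
  obtain ⟨x, ⟨y, hy⟩, rfl⟩ := hz
  change _ ≤ ‖(x : Khat E)‖
  change 1 < ‖(x : Khat E)‖ at h
  rw [UniformSpace.Completion.norm_coe, norm_puiseux] at h ⊢
  have hx : (x : HahnSeries ℚ E) ≠ 0 := by
    intro h0
    rw [h0, map_zero] at h
    exact absurd h (by norm_num)
  have hn : (0 : ℝ) < (n : ℝ) := by exact_mod_cast n.pos
  rw [hahnAbs_of_ne E hx] at h ⊢
  rw [Real.exp_le_exp]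
  rw [Real.one_lt_exp_iff] at h
  have hc := HahnSeries.coeff_order_eq_zero.not.2 hx
  have hy' : laurentEmb E n y = (x : HahnSeries ℚ E) := hy
  obtain ⟨k, hk⟩ : ∃ k : ℤ, (k : ℚ) / (n : ℚ) = (x : HahnSeries ℚ E).order := by
    by_contra! hne
    exact hc ((congrArg (fun u : HahnSeries ℚ E => u.coeff (x : HahnSeries ℚ E).order)
      hy').symm.trans
      (coeff_laurentEmb_of_ne E n y _ hne))
  rw [← hk] at h ⊢
  push_cast at h ⊢
  rw [← neg_div] at h ⊢
  rw [div_le_div_iff_of_pos_right hn]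
  have h1 : (0 : ℝ) < -(k : ℝ) := (div_pos_iff_of_pos_right hn).1 h
  have h2 : 0 < -k := by exact_mod_cast h1
  exact_mod_cast h2

variable (E) in
/-- The monomial `t ^ (-q)`. -/
noncomputable def monom (q : ℚ) : Puiseux E :=
  ⟨HahnSeries.single q 1, by
    rw [mem_puiseuxSubfield]
    refine ⟨⟨q.den, q.den_pos⟩, HahnSeries.single q.num 1, ?_⟩
    refine HahnSeries.embDomain_single.trans ?_
    exact congrArg (fun r => HahnSeries.single r (1 : E)) (Rat.num_div_den q)⟩

theorem norm_monom (q : ℚ) : ‖monom E q‖ = Real.exp (-(q : ℝ)) := by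
  rw [norm_puiseux, hahnAbs_of_ne]
  · rw [monom, HahnSeries.order_single one_ne_zero]
  · exact HahnSeries.single_ne_zero one_ne_zero

end Puiseux

/-! ### Continued fractions as Möbius images of the set of tails -/

section Expressions

variable {E : Type*} [Field E]

/-- The Möbius map `w ↦ f₀ + 1 / (f₁ + ⋯ + 1 / (fₙ + 1 / w))`, with `1 / 0 = 0`. -/
noncomputable def phi (l : List (Khat E)) (w : Khat E) : Khat E := l.foldr (fun f w => f + w⁻¹) w

@[simp] theorem phi_nil (w : Khat E) : phi [] w = w := rfl

@[simp] theorem phi_cons (f : Khat E) (l : List (Khat E)) (w : Khat E) :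
    phi (f :: l) w = f + (phi l w)⁻¹ := rfl

theorem phi_append (l m : List (Khat E)) (w : Khat E) : phi (l ++ m) w = phi l (phi m w) :=
  List.foldr_append ..

theorem eval_eq_phi : ∀ l : List (Khat E), eval l = phi l 0
  | [] => rfl
  | [f] => by simp [eval]
  | f :: g :: l => by rw [eval, eval_eq_phi (g :: l)]; rfl

/-- With `0⁻¹ = 0` inversion is a bijection of the whole field, so no pole has to be excluded. -/
theorem phi_injective (l : List (Khat E)) : Function.Injective (phi l) := by
  induction l with
  | nil => exact fun _ _ h => h
  | cons f l ih => exact fun _ _ h => ih (inv_injective (add_left_cancel h))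

theorem phi_surjective (l : List (Khat E)) : Function.Surjective (phi l) := by
  induction l with
  | nil => exact fun w => ⟨w, rfl⟩
  | cons f l ih =>
    intro z
    obtain ⟨w, hw⟩ := ih (z - f)⁻¹
    exact ⟨w, by rw [phi_cons, hw, inv_inv, add_sub_cancel]⟩

variable (E) in
/-- The possible values of the tails of an expression, `0` standing for the empty tail. -/
noncomputable def tails : Set (Khat E) := {w | w = 0 ∨ 1 < ‖w‖}

theorem zero_mem_tails : (0 : Khat E) ∈ tails E := Or.inl rfl

theorem mem_tails_iff {w : Khat E} : w ∈ tails E ↔ ‖w⁻¹‖ < 1 := by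
  rw [norm_inv]
  by_cases h : w = 0
  · simp [h, zero_mem_tails]
  · rw [inv_lt_one₀ (norm_pos_iff.2 h)]
    exact or_iff_right h

/-- The leading term dominates, since the reciprocal of a tail has norm below `1`. -/
theorem norm_phi_cons {g : Khat E} {l : List (Khat E)} {w : Khat E} (hg : 1 < ‖g‖)
    (hw : phi l w ∈ tails E) : ‖phi (g :: l) w‖ = ‖g‖ := by
  refine norm_eq_of_norm_sub_lt ?_
  rw [phi_cons, sub_add_cancel_left, norm_neg]
  exact (mem_tails_iff.1 hw).trans hg

theorem phi_mem_tails {l : List (Khat E)} (hl : ∀ g ∈ l, 1 < ‖g‖) {w : Khat E}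
    (hw : w ∈ tails E) : phi l w ∈ tails E := by
  induction l with
  | nil => exact hw
  | cons g l ih =>
    rw [List.forall_mem_cons] at hl
    exact Or.inr (by rw [norm_phi_cons hl.1 (ih hl.2)]; exact hl.1)

/-- The radius `exp (-2 ∑ deg f)` of the ball of an expression whose terms after the first are
the given ones. -/
noncomputable def rad (m : List (Khat E)) : ℝ := Real.exp (-(2 * (m.map deg).sum))

theorem rad_pos (m : List (Khat E)) : 0 < rad m := Real.exp_pos _

theorem rad_nil : rad ([] : List (Khat E)) = 1 := by simp [rad]

theorem rad_cons {g : Khat E} (hg : 1 < ‖g‖) (m : List (Khat E)) :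
    rad (g :: m) = rad m / ‖g‖ ^ 2 := by
  have h0 : 0 < ‖g‖ := one_pos.trans hg
  rw [rad, rad, List.map_cons, List.sum_cons, deg_eq_log_norm, mul_add, neg_add, add_comm,
    Real.exp_add, div_eq_mul_inv, Real.exp_neg (2 * Real.log _), two_mul (Real.log _), Real.exp_add,
    Real.exp_log h0, sq]

theorem rad_le_one {m : List (Khat E)} (hm : ∀ g ∈ m, 1 < ‖g‖) : rad m ≤ 1 := by
  rw [rad, Real.exp_le_one_iff, neg_nonpos]
  refine mul_nonneg two_pos.le (List.sum_nonneg ?_)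
  simp only [List.mem_map, forall_exists_index, and_imp, forall_apply_eq_imp_iff₂]
  exact fun g hg => (deg_pos_iff.2 (hm g hg)).le

/-- Two tails starting with `g` both have norm `‖g‖`, so `x⁻¹ - y⁻¹ = (y - x) / (x y)` contributes a
factor `‖g‖⁻²`. Working with `w⁻¹` treats the empty tail on the same footing. -/
theorem norm_phi_sub_phi (f : Khat E) {m : List (Khat E)} (hm : ∀ g ∈ m, 1 < ‖g‖)
    {w w' : Khat E} (hw : w ∈ tails E) (hw' : w' ∈ tails E) :
    ‖phi (f :: m) w - phi (f :: m) w'‖ = rad m * ‖w⁻¹ - w'⁻¹‖ := by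
  induction m generalizing f with
  | nil => simp [rad_nil]
  | cons g m ih =>
    have hm' := List.forall_mem_cons.1 hm
    have h1 := norm_phi_cons hm'.1 (phi_mem_tails hm'.2 hw)
    have h2 := norm_phi_cons hm'.1 (phi_mem_tails hm'.2 hw')
    have hg : 0 < ‖g‖ := one_pos.trans hm'.1
    rw [phi_cons f, phi_cons f, add_sub_add_left_eq_sub,
      inv_sub_inv (norm_pos_iff.1 (h1 ▸ hg)) (norm_pos_iff.1 (h2 ▸ hg)), norm_div, norm_mul, h1, h2,
      norm_sub_rev, ih g hm'.2, rad_cons hm'.1]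
    ring

theorem exists_phi_eq_of_norm_sub_lt (f : Khat E) {m : List (Khat E)} (hm : ∀ g ∈ m, 1 < ‖g‖)
    {z : Khat E} (hz : ‖z - phi (f :: m) 0‖ < rad m) :
    ∃ w ∈ tails E, phi (f :: m) w = z := by
  induction m generalizing f z with
  | nil =>
    refine ⟨(z - f)⁻¹, mem_tails_iff.2 ?_, by simp⟩
    simpa [rad_nil] using hz
  | cons g m ih =>
    have hm' := List.forall_mem_cons.1 hm
    have he := norm_phi_cons hm'.1 (phi_mem_tails hm'.2 (zero_mem_tails (E := E)))
    have hg : 0 < ‖g‖ := one_pos.trans hm'.1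
    set e := phi (g :: m) 0
    have he0 : e ≠ 0 := norm_pos_iff.1 (he ▸ hg)
    have h1 : ‖e⁻¹ - (z - f)‖ < rad m / ‖g‖ ^ 2 := by
      rw [← rad_cons hm'.1, norm_sub_rev, ← sub_add_eq_sub_sub]
      exact hz
    -- The radius `rad m / ‖g‖ ^ 2` is less than `‖e⁻¹‖`, so the whole ball keeps away from `0` and
    -- inversion scales it exactly by `‖g‖ ^ 2`.
    have h2 : ‖z - f‖ = ‖g‖⁻¹ := by
      rw [← he, ← norm_inv]
      refine norm_eq_of_norm_sub_lt (h1.trans_le ?_)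
      rw [norm_inv, he, div_le_iff₀ (by positivity), sq, inv_mul_cancel_left₀ hg.ne']
      exact (rad_le_one hm'.2).trans hm'.1.le
    have h0 : z - f ≠ 0 := norm_pos_iff.1 (h2 ▸ inv_pos.2 hg)
    obtain ⟨w, hw, hwz⟩ := ih g hm'.2 (z := (z - f)⁻¹) (by
      rw [lt_div_iff₀ (by positivity)] at h1
      refine lt_of_eq_of_lt ?_ h1
      change ‖_ - e‖ = _
      have : (z - f)⁻¹ - e = (e⁻¹ - (z - f)) * (e * (z - f)⁻¹) := by
        field_simp
      rw [this, norm_mul, norm_mul, norm_inv, h2, he, inv_inv, sq])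
    exact ⟨w, hw, by rw [phi_cons, hwz, inv_inv, add_sub_cancel]⟩

/-- The set of the values of the expressions that start with `l`, when `l` is nonempty. -/
noncomputable def cell (l : List (Khat E)) : Set (Khat E) := phi l '' tails E

theorem cell_cons (f : Khat E) {m : List (Khat E)} (hm : ∀ g ∈ m, 1 < ‖g‖) :
    cell (f :: m) = Metric.ball (eval (f :: m)) (rad m) := by
  rw [eval_eq_phi]
  ext z
  rw [mem_ball_iff_norm]
  refine ⟨?_, exists_phi_eq_of_norm_sub_lt f hm⟩
  rintro ⟨w, hw, rfl⟩
  rw [norm_phi_sub_phi f hm hw zero_mem_tails, inv_zero, sub_zero]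
  exact mul_lt_of_lt_one_right (rad_pos m) (mem_tails_iff.1 hw)

theorem IsExpr.nil : IsExpr ([] : List (Khat E)) := by simp [IsExpr]

theorem isExpr_cons {f : Khat E} {l : List (Khat E)} :
    IsExpr (f :: l) ↔ f ∈ puiseuxPoly E ∧ ∀ g ∈ l, g ∈ puiseuxPoly E ∧ 1 < ‖g‖ := by
  simp only [IsExpr, List.forall_mem_cons, List.tail_cons, deg_pos_iff, and_assoc, ← forall_and]

theorem IsExpr.tail {f : Khat E} {l : List (Khat E)} (h : IsExpr (f :: l)) : IsExpr l := by
  rw [isExpr_cons] at h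
  exact ⟨fun g hg => (h.2 g hg).1, fun g hg => deg_pos_iff.2 (h.2 g (List.mem_of_mem_tail hg)).2⟩

theorem isExpr_append {l m : List (Khat E)} (hl : l ≠ []) :
    IsExpr (l ++ m) ↔ IsExpr l ∧ ∀ g ∈ m, g ∈ puiseuxPoly E ∧ 1 < ‖g‖ := by
  obtain ⟨f, l, rfl⟩ := List.exists_cons_of_ne_nil hl
  rw [List.cons_append, isExpr_cons, isExpr_cons, List.forall_mem_append, and_assoc]

theorem isExpr_append_singleton {l : List (Khat E)} (h : IsExpr l) {g : Khat E}
    (hg : g ∈ puiseuxPoly E) (hg' : l ≠ [] → 1 < ‖g‖) : IsExpr (l ++ [g]) := by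
  by_cases hl : l = []
  · subst hl
    simp [isExpr_cons, hg]
  · rw [isExpr_append hl]
    exact ⟨h, by simpa using ⟨hg, hg' hl⟩⟩

theorem IsExpr.of_prefix {l l' : List (Khat E)} (h : l <+: l') (hl' : IsExpr l') : IsExpr l := by
  obtain ⟨m, rfl⟩ := h
  by_cases hl : l = []
  · rw [hl]; exact IsExpr.nil
  · exact ((isExpr_append hl).1 hl').1

theorem cell_eq_ball {l : List (Khat E)} (hl : l ≠ []) (h : IsExpr l) :
    cell l = Metric.ball (eval l) (rad l.tail) := by
  obtain ⟨f, l, rfl⟩ := List.exists_cons_of_ne_nil hl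
  exact cell_cons f fun g hg => ((isExpr_cons.1 h).2 g hg).2

theorem cell_subset_of_prefix {l l' : List (Khat E)} (hl : l ≠ []) (h : l <+: l')
    (hl' : IsExpr l') : cell l' ⊆ cell l := by
  obtain ⟨m, rfl⟩ := h
  rintro _ ⟨w, hw, rfl⟩
  rw [phi_append]
  exact ⟨_, phi_mem_tails (fun g hg => (((isExpr_append hl).1 hl').2 g hg).2) hw, rfl⟩

theorem eval_mem_cell (l : List (Khat E)) : eval l ∈ cell l :=
  ⟨0, zero_mem_tails, (eval_eq_phi l).symm⟩

theorem phi_mem_tails_of_isExpr {f : Khat E} {l : List (Khat E)} (h : IsExpr (f :: l))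
    {w : Khat E} (hw : w ∈ tails E) : phi l w ∈ tails E :=
  phi_mem_tails (fun g hg => ((isExpr_cons.1 h).2 g hg).2) hw

theorem norm_phi_cons_sub_lt_one {f : Khat E} {l : List (Khat E)} (h : IsExpr (f :: l))
    {w : Khat E} (hw : w ∈ tails E) : ‖phi (f :: l) w - f‖ < 1 := by
  rw [phi_cons, add_sub_cancel_left]
  exact mem_tails_iff.1 (phi_mem_tails_of_isExpr h hw)

/-- Uniqueness of expansions: the first term is the only polynomial at distance less than `1` from
the value; cancel it, invert and recurse. -/
theorem prefix_or_prefix_of_phi_eq : ∀ {l m : List (Khat E)}, IsExpr l → IsExpr m →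
    ∀ {v w : Khat E}, v ∈ tails E → w ∈ tails E → phi l v = phi m w → l <+: m ∨ m <+: l
  | [], m, _, _, _, _, _, _, _ => Or.inl (List.nil_prefix)
  | l, [], _, _, _, _, _, _, _ => Or.inr (List.nil_prefix)
  | f :: l, g :: m, hl, hm, v, w, hv, hw, h => by
    have hfg : f = g := by
      refine eq_of_mem_puiseuxPoly (isExpr_cons.1 hl).1 (isExpr_cons.1 hm).1 ?_
      refine norm_sub_lt_of_lt (b := phi (f :: l) v) ?_ ?_
      · rw [norm_sub_rev]; exact norm_phi_cons_sub_lt_one hl hv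
      · rw [h]; exact norm_phi_cons_sub_lt_one hm hw
    subst hfg
    have h' : phi l v = phi m w := inv_injective (add_left_cancel h)
    simpa only [List.cons_prefix_cons, true_and] using
      prefix_or_prefix_of_phi_eq hl.tail hm.tail hv hw h'

theorem prefix_or_prefix_of_mem_cell {l m : List (Khat E)} (hl : IsExpr l) (hm : IsExpr m)
    {z : Khat E} (hzl : z ∈ cell l) (hzm : z ∈ cell m) : l <+: m ∨ m <+: l := by
  obtain ⟨v, hv, rfl⟩ := hzl
  obtain ⟨w, hw, h⟩ := hzm
  exact prefix_or_prefix_of_phi_eq hl hm hv hw h.symm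

/-- The polynomial part of an element of level `n` has level `n`, and so does the inverse of the
remainder: the expansion never leaves the field. -/
theorem mem_puiseuxLevel_of_phi_mem {n : ℕ+} : ∀ {l : List (Khat E)}, IsExpr l →
    ∀ {w : Khat E}, w ∈ tails E → phi l w ∈ puiseuxLevel E n → ∀ g ∈ l, g ∈ puiseuxLevel E n
  | [], _, _, _, _ => by simp
  | f :: l, hl, w, hw, h => by
    obtain ⟨p, hp, hpn, hpw⟩ := exists_poly_of_mem_puiseuxLevel h
    have hf : f = p := by
      refine eq_of_mem_puiseuxPoly (isExpr_cons.1 hl).1 hp ?_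
      refine norm_sub_lt_of_lt (b := phi (f :: l) w) ?_ hpw
      rw [norm_sub_rev]; exact norm_phi_cons_sub_lt_one hl hw
    rw [List.forall_mem_cons]
    refine ⟨hf ▸ hpn, mem_puiseuxLevel_of_phi_mem hl.tail hw ?_⟩
    rw [← inv_inv (phi l w)]
    refine inv_mem ?_
    rw [← add_sub_cancel_left f (phi l w)⁻¹]
    exact sub_mem h (hf ▸ hpn)

theorem sum_map_range {M : Type*} [AddCommMonoid M] (f : ℕ → M) (n : ℕ) :
    ((List.range n).map f).sum = ∑ i ∈ Finset.range n, f i := by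
  induction n with
  | zero => simp
  | succ n ih => rw [List.range_succ, List.map_append, List.sum_append, ih,
      Finset.sum_range_succ]; simp

theorem trunc_eq_cons (f : ℕ → Khat E) (n : ℕ) :
    trunc f n = f 0 :: (List.range n).map (fun i => f (i + 1)) := by
  rw [trunc, List.range_succ_eq_map, List.map_cons, List.map_map]
  rfl

theorem trunc_ne_nil (f : ℕ → Khat E) (n : ℕ) : trunc f n ≠ [] := by
  rw [trunc_eq_cons]; exact List.cons_ne_nil _ _

theorem length_trunc (f : ℕ → Khat E) (n : ℕ) : (trunc f n).length = n + 1 := by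
  simp [trunc]

theorem trunc_prefix_trunc (f : ℕ → Khat E) {m n : ℕ} (h : m ≤ n) : trunc f m <+: trunc f n := by
  obtain ⟨k, rfl⟩ := Nat.exists_eq_add_of_le h
  rw [trunc, trunc, show m + k + 1 = m + 1 + k by ring, List.range_add (n := m + 1),
    List.map_append]
  exact List.prefix_append _ _

theorem IsInfExpr.isExpr_trunc {f : ℕ → Khat E} (hf : IsInfExpr f) (n : ℕ) :
    IsExpr (trunc f n) := by
  rw [trunc_eq_cons, isExpr_cons]
  refine ⟨hf.1 0, fun g hg => ?_⟩
  obtain ⟨i, -, rfl⟩ := List.mem_map.1 hg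
  exact ⟨hf.1 _, deg_pos_iff.1 (hf.2 _ i.succ_pos)⟩

theorem isInfExpr_of_isExpr_trunc {f : ℕ → Khat E} (hf : ∀ n, IsExpr (trunc f n)) :
    IsInfExpr f := by
  refine ⟨fun i => (hf i).1 _ ?_, fun i hi => ?_⟩
  · exact List.mem_map.2 ⟨i, List.mem_range.2 i.lt_succ_self, rfl⟩
  · refine (hf i).2 _ ?_
    rw [trunc_eq_cons, List.tail_cons, List.mem_map]
    exact ⟨i - 1, List.mem_range.2 (by omega), by rw [Nat.sub_add_cancel hi]⟩

theorem rad_tail_trunc (f : ℕ → Khat E) (n : ℕ) :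
    rad (trunc f n).tail = Real.exp (-(2 * ∑ i ∈ Finset.range n, deg (f (i + 1)))) := by
  rw [rad, trunc_eq_cons, List.tail_cons, List.map_map, sum_map_range]
  rfl

theorem IsInfExpr.exists_notMem_cell {f : ℕ → Khat E} (hf : IsInfExpr f) {C : ℝ}
    (hC : ∀ n, ∑ i ∈ Finset.range n, deg (f (i + 1)) ≤ C) (z : Khat E) :
    ∃ n, z ∉ cell (trunc f n) := by
  by_contra! hz
  -- No ball has radius below `exp (-2C)`, so this `x` lies in all of them together with `z`.
  obtain ⟨x, hx⟩ := exists_puiseux_norm_sub_lt z (Real.exp_pos (-(2 * C)))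
  obtain ⟨N, hN⟩ := exists_mem_puiseuxLevel x
  have hNpos : (0 : ℝ) < (N : ℝ) := by exact_mod_cast N.pos
  obtain ⟨n, hn⟩ := exists_nat_gt (C * N)
  have hxn : (x : Khat E) ∈ cell (trunc f n) := by
    have h := hz n
    rw [cell_eq_ball (trunc_ne_nil f n) (hf.isExpr_trunc n), mem_ball_iff_norm] at h ⊢
    refine norm_sub_lt_of_lt ?_ h
    rw [norm_sub_rev, rad_tail_trunc]
    refine hx.trans_le (Real.exp_le_exp.2 ?_)
    linarith [hC n]
  obtain ⟨w, hw, hwx⟩ := hxn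
  have hmem := mem_puiseuxLevel_of_phi_mem (hf.isExpr_trunc n) hw (hwx ▸ hN)
  have hdeg : ∀ i ∈ Finset.range n, (1 : ℝ) / N ≤ deg (f (i + 1)) := by
    intro i hi
    have h1 : 1 < ‖f (i + 1)‖ := deg_pos_iff.1 (hf.2 _ i.succ_pos)
    rw [deg_eq_log_norm, Real.le_log_iff_exp_le (one_pos.trans h1)]
    refine le_norm_of_mem_puiseuxLevel (hmem _ ?_) h1
    exact List.mem_map.2 ⟨i + 1, List.mem_range.2 (by have := Finset.mem_range.1 hi; omega), rfl⟩
  have hsum := (Finset.card_nsmul_le_sum _ _ _ hdeg).trans (hC n)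
  rw [Finset.card_range, nsmul_eq_mul, mul_one_div, div_le_iff₀ hNpos] at hsum
  exact absurd hn (not_lt.2 hsum)

theorem exists_seq_of_forall_exists_append {α : Type*} {P : List α → Prop} (h0 : P [])
    (h : ∀ l, P l → ∃ a, P (l ++ [a])) : ∃ f : ℕ → α, ∀ n, P ((List.range n).map f) := by
  choose a ha using h
  let L : ℕ → {l // P l} := fun n => n.rec ⟨[], h0⟩ fun _ l => ⟨l.1 ++ [a l.1 l.2], ha l.1 l.2⟩
  refine ⟨fun n => a (L n).1 (L n).2, fun n => ?_⟩
  have : (List.range n).map (fun n => a (L n).1 (L n).2) = (L n).1 := by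
    induction n with
    | zero => rfl
    | succ n ih => rw [List.range_succ, List.map_append, ih]; rfl
  rw [this]
  exact (L n).2

theorem IsInfExpr.tendsto_rad {f : ℕ → Khat E} (hf : IsInfExpr f)
    (h : ∀ C : ℝ, ∃ n, C < ∑ i ∈ Finset.range n, deg (f (i + 1))) :
    Tendsto (fun n => rad (trunc f n).tail) atTop (𝓝 0) := by
  have hmono : Monotone fun n => ∑ i ∈ Finset.range n, deg (f (i + 1)) :=
    monotone_nat_of_le_succ fun n => by
      rw [Finset.sum_range_succ]
      linarith [hf.2 _ n.succ_pos]
  have hS : Tendsto (fun n => ∑ i ∈ Finset.range n, deg (f (i + 1))) atTop atTop :=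
    tendsto_atTop_atTop_of_monotone hmono fun C => (h C).imp fun _ hn => hn.le
  simp only [rad_tail_trunc]
  exact Real.tendsto_exp_neg_atTop_nhds_zero.comp (hS.const_mul_atTop two_pos)

/-- A common point excludes bounded degree sums, so the radii tend to `0`. -/
theorem IsInfExpr.tendsto_eval {f : ℕ → Khat E} (hf : IsInfExpr f) {z : Khat E}
    (hz : ∀ n, z ∈ cell (trunc f n)) : Tendsto (fun n => eval (trunc f n)) atTop (𝓝 z) := by
  rw [tendsto_iff_norm_sub_tendsto_zero]
  refine squeeze_zero (fun _ => norm_nonneg _) (fun n => ?_) (hf.tendsto_rad fun C => ?_)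
  · have h := hz n
    rw [cell_eq_ball (trunc_ne_nil f n) (hf.isExpr_trunc n), mem_ball_iff_norm, norm_sub_rev] at h
    exact h.le
  · by_contra! hC
    obtain ⟨n, hn⟩ := hf.exists_notMem_cell hC z
    exact hn (hz n)

theorem exists_isInfExpr_of_forall_eval_ne {z : Khat E}
    (hz : ∀ l, l ≠ [] → IsExpr l → eval l ≠ z) :
    ∃ f : ℕ → Khat E, IsInfExpr f ∧ ∀ n, z ∈ cell (trunc f n) := by
  obtain ⟨f, hf⟩ := exists_seq_of_forall_exists_append
    -- The expansion algorithm, with current remainder `w`. The initial remainder is `z` itself,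
    -- which need not be a tail; later ones are nonzero because `z` has no finite expansion.
    (P := fun l => IsExpr l ∧ ∃ w, (l ≠ [] → w ∈ tails E) ∧ phi l w = z)
    ⟨IsExpr.nil, z, fun h => absurd rfl h, rfl⟩ (by
      rintro l ⟨hl, w, hw, rfl⟩
      obtain ⟨p, hp, hpw⟩ := exists_poly w
      refine ⟨p, isExpr_append_singleton hl hp fun hl0 => ?_, (w - p)⁻¹, fun _ => ?_, ?_⟩
      · have hw1 : 1 < ‖w‖ := by
          refine (hw hl0).resolve_left fun h0 => hz l hl0 hl ?_
          rw [eval_eq_phi, h0]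
        rwa [norm_eq_of_norm_sub_lt (hpw.trans hw1)]
      · rwa [mem_tails_iff, inv_inv]
      · rw [phi_append, phi_cons, phi_nil, inv_inv, add_sub_cancel])
  refine ⟨f, isInfExpr_of_isExpr_trunc fun n => (hf _).1, fun n => ?_⟩
  obtain ⟨-, w, hw, h⟩ := hf (n + 1)
  exact ⟨w, hw (trunc_ne_nil f n), h⟩

/-- Limits stay in the cell because ultrametric open balls are closed. Conversely, each point of the
cell has some expansion, which by uniqueness must start with `l`. -/
theorem ballOf_eq_cell {l : List (Khat E)} (hl0 : l ≠ []) (hl : IsExpr l) :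
    ballOf l = cell l := by
  ext z
  constructor
  · rintro (⟨l', -, hl', hp, rfl⟩ | ⟨f, hf, ⟨n, hn⟩, hz⟩)
    · exact cell_subset_of_prefix hl0 hp hl' (eval_mem_cell l')
    · have hcl : IsClosed (cell l) := by
        rw [cell_eq_ball hl0 hl]
        exact IsUltrametricDist.isClosed_ball _ _
      refine hcl.mem_of_tendsto hz (eventually_atTop.2 ⟨n, fun k hk => ?_⟩)
      exact cell_subset_of_prefix hl0 (hn.trans (trunc_prefix_trunc f hk)) (hf.isExpr_trunc k)
        (eval_mem_cell _)
  · intro hz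
    by_cases hfin : ∃ l', l' ≠ [] ∧ IsExpr l' ∧ eval l' = z
    · obtain ⟨l', hl0', hl', rfl⟩ := hfin
      rcases prefix_or_prefix_of_mem_cell hl hl' hz (eval_mem_cell l') with h | h
      · exact Or.inl ⟨l', hl0', hl', h, rfl⟩
      -- Here the expansion `l'` is a prefix of `l`, so the remainder after `l'` is `0`. A nonempty
      -- rest `g :: m` would give that remainder norm `‖g‖ > 1`.
      · obtain ⟨m, rfl⟩ := h
        obtain ⟨w, hw, h⟩ := hz
        rw [phi_append, eval_eq_phi] at h
        have h0 := phi_injective _ h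
        have hm := ((isExpr_append hl0').1 hl).2
        cases m with
        | nil => exact Or.inl ⟨l', hl0', hl', by rw [List.append_nil], rfl⟩
        | cons g m =>
          rw [List.forall_mem_cons] at hm
          have := norm_phi_cons hm.1.2 (phi_mem_tails (fun g hg => (hm.2 g hg).2) hw)
          rw [h0, norm_zero] at this
          linarith [hm.1.2]
    · push Not at hfin
      obtain ⟨f, hf, hzf⟩ := exists_isInfExpr_of_forall_eval_ne hfin
      refine Or.inr ⟨f, hf, ⟨l.length, ?_⟩, hf.tendsto_eval hzf⟩
      refine (prefix_or_prefix_of_mem_cell hl (hf.isExpr_trunc _) hz (hzf l.length)).resolve_right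
        fun h => ?_
      have := h.length_le
      rw [length_trunc] at this
      omega

theorem ballOf_eq_ball {l : List (Khat E)} (hl0 : l ≠ []) (hl : IsExpr l) :
    ballOf l = Metric.ball (eval l) (rad l.tail) := by
  rw [ballOf_eq_cell hl0 hl, cell_eq_ball hl0 hl]

theorem ballOf_anti {l l' : List (Khat E)} (h : l <+: l') : ballOf l' ⊆ ballOf l := by
  rintro z (⟨m, hm0, hm, hp, hz⟩ | ⟨f, hf, ⟨n, hn⟩, hz⟩)
  · exact Or.inl ⟨m, hm0, hm, h.trans hp, hz⟩
  · exact Or.inr ⟨f, hf, ⟨n, h.trans hn⟩, hz⟩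

theorem ballOf_nil : ballOf ([] : List (Khat E)) = Set.univ := by
  refine Set.eq_univ_of_forall fun z => ?_
  obtain ⟨p, hp, hpz⟩ := exists_poly z
  refine ballOf_anti (List.nil_prefix (l := [p])) ?_
  rw [ballOf_eq_ball (List.cons_ne_nil _ _) (isExpr_cons.2 ⟨hp, by simp⟩), mem_ball_iff_norm]
  simpa [eval, rad_nil] using hpz

theorem ballOf_append_singleton {l : List (Khat E)} {h : Khat E} (hl : IsExpr (l ++ [h])) :
    ballOf (l ++ [h]) = phi l '' Metric.ball h 1 := by
  have h1 : cell [h] = Metric.ball h 1 := by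
    rw [cell_cons h (by simp), rad_nil]; rfl
  rw [ballOf_eq_cell (by simp) hl, cell, ← h1, cell, Set.image_image]
  simp only [phi_append]

/-- If the balls of two expressions have a common element, one of them starts with the other. -/
theorem prefix_or_prefix_of_mem_ballOf {l m : List (Khat E)} (hl : IsExpr l) (hm : IsExpr m)
    {z : Khat E} (hzl : z ∈ ballOf l) (hzm : z ∈ ballOf m) : l <+: m ∨ m <+: l := by
  by_cases hl0 : l = []
  · rw [hl0]; exact Or.inl List.nil_prefix
  by_cases hm0 : m = []
  · rw [hm0]; exact Or.inr List.nil_prefix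
  rw [ballOf_eq_cell hl0 hl] at hzl
  rw [ballOf_eq_cell hm0 hm] at hzm
  exact prefix_or_prefix_of_mem_cell hl hm hzl hzm

end Expressions

/-! ### Balls and their points on the Berkovich line -/

section BallPoints

open Polynomial

variable {E : Type*} [Field E]

theorem ballPointA1_add_le_max (a : Khat E) (r : ℝ) (f g : (Khat E)[X]) :
    (ballPointA1 a r).1 (f + g) ≤ max ((ballPointA1 a r).1 f) ((ballPointA1 a r).1 g) := by
  change (taylor a (f + g)).gaussNorm _ _ ≤ _
  rw [map_add]
  exact isNonarchimedean_gaussNorm (NormedField.toAbsoluteValue (Khat E))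
    (fun x y => IsUltrametricDist.norm_add_le_max x y) (Real.exp_pos (-r)).le _ _

theorem ballPointA1_X_sub_C (a b : Khat E) (r : ℝ) :
    (ballPointA1 a r).1 (X - C b) = max ‖a - b‖ (Real.exp (-r)) := by
  have hc : 0 ≤ Real.exp (-r) := (Real.exp_pos (-r)).le
  have h : taylor a (X - C b) = X + C (a - b) := by
    rw [map_sub, taylor_X, taylor_C, C_sub, add_sub_assoc]
  change (taylor a (X - C b)).gaussNorm (NormedField.toAbsoluteValue (Khat E)) _ = _
  rw [h]
  apply le_antisymm
  · refine (isNonarchimedean_gaussNorm (NormedField.toAbsoluteValue (Khat E))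
      (fun x y => IsUltrametricDist.norm_add_le_max x y) hc _ _).trans ?_
    rw [gaussNorm_C, ← monomial_one_one_eq_X, gaussNorm_monomial, map_one, one_mul, pow_one,
      max_comm]
    rfl
  · refine max_le ?_ ?_
    · have h0 := le_gaussNorm (NormedField.toAbsoluteValue (Khat E)) (X + C (a - b)) hc 0
      rwa [coeff_add, coeff_X_zero, coeff_C_zero, zero_add, pow_zero, mul_one] at h0
    · have h1 := le_gaussNorm (NormedField.toAbsoluteValue (Khat E)) (X + C (a - b)) hc 1
      rwa [coeff_add, coeff_X_one, coeff_C_of_ne_zero one_ne_zero, add_zero, map_one, one_mul,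
        pow_one] at h1

/-- Expand `f` in powers of `X - a`: multiplicativity and the ultrametric inequality reduce the
comparison to `X - a`. -/
theorem ballPointA1_le_of_X_sub_C_le {a b : Khat E} {r s : ℝ}
    (h : (ballPointA1 b s).1 (X - C a) ≤ Real.exp (-r)) (f : (Khat E)[X]) :
    (ballPointA1 b s).1 f ≤ (ballPointA1 a r).1 f := by
  conv_lhs => rw [← sum_taylor_eq f a]
  refine Finset.sum_induction _ (fun p => (ballPointA1 b s).1 p ≤ (ballPointA1 a r).1 f)
    (fun p q hp hq => (ballPointA1_add_le_max b s p q).trans (max_le hp hq)) ?_ ?_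
  · rw [map_zero]
    exact apply_nonneg _ _
  · intro i _
    rw [map_mul, map_pow, (ballPointA1 b s).2]
    refine (mul_le_mul_of_nonneg_left (pow_le_pow_left₀ (apply_nonneg _ _) h i)
      (norm_nonneg _)).trans ?_
    exact le_gaussNorm (NormedField.toAbsoluteValue (Khat E)) (taylor a f)
      (Real.exp_pos (-r)).le i

theorem openBall_subset_closedBall (a : Khat E) (r : ℝ) : openBall a r ⊆ closedBall a r :=
  fun b h => le_of_lt (show (r : WithTop ℝ) < val (b - a) from h)

theorem mem_closedBall_self (a : Khat E) (r : ℝ) : a ∈ closedBall a r := by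
  rw [closedBall_eq_closedBall]
  exact Metric.mem_closedBall_self (Real.exp_pos _).le

theorem mem_openBall_self (a : Khat E) (r : ℝ) : a ∈ openBall a r := by
  rw [openBall_eq_ball]
  exact Metric.mem_ball_self (Real.exp_pos _)

theorem mem_closedBall_iff {a b : Khat E} {r : ℝ} :
    b ∈ closedBall a r ↔ ‖b - a‖ ≤ Real.exp (-r) := by
  rw [closedBall_eq_closedBall, mem_closedBall_iff_norm]

/-- The value group is dense: a monomial with exponent strictly between `s` and `r` would lead out
of the larger ball. This is what makes the parameter of a ball well defined. -/
theorem le_of_openBall_subset_closedBall {a b : Khat E} {r s : ℝ}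
    (h : openBall b s ⊆ closedBall a r) : r ≤ s := by
  by_contra! hsr
  obtain ⟨q, hsq, hqr⟩ := exists_rat_btwn hsr
  have h1 := mem_closedBall_iff.1 (h (mem_openBall_self b s))
  have hm : ‖(monom E q : Khat E)‖ = Real.exp (-(q : ℝ)) := by
    rw [UniformSpace.Completion.norm_coe, norm_monom]
  have h2 : b + monom E q ∈ closedBall a r := by
    refine h ?_
    rw [openBall_eq_ball, mem_ball_iff_norm, add_sub_cancel_left, hm]
    exact Real.exp_lt_exp.2 (neg_lt_neg hsq)
  have h3 := norm_sub_le_of_le (mem_closedBall_iff.1 h2) (norm_sub_rev b a ▸ h1)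
  rw [add_sub_cancel_left, hm, Real.exp_le_exp, neg_le_neg_iff] at h3
  linarith

theorem closedBall_subset_closedBall {a b : Khat E} {r s : ℝ} (hrs : r ≤ s)
    (hb : b ∈ closedBall a r) : closedBall b s ⊆ closedBall a r := by
  intro z hz
  rw [mem_closedBall_iff] at hb hz ⊢
  exact norm_sub_le_of_le (hz.trans (Real.exp_le_exp.2 (neg_le_neg hrs))) hb

theorem ballPointA1_le_of_subset {a b : Khat E} {r s : ℝ}
    (h : openBall b s ⊆ closedBall a r) (f : (Khat E)[X]) :
    (ballPointA1 b s).1 f ≤ (ballPointA1 a r).1 f := by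
  refine ballPointA1_le_of_X_sub_C_le ?_ f
  rw [ballPointA1_X_sub_C]
  exact max_le (mem_closedBall_iff.1 (h (mem_openBall_self b s)))
    (Real.exp_le_exp.2 (neg_le_neg (le_of_openBall_subset_closedBall h)))

theorem ballPointA1_le_of_closedBall_subset {a b : Khat E} {r s : ℝ}
    (h : closedBall b s ⊆ closedBall a r) (f : (Khat E)[X]) :
    (ballPointA1 b s).1 f ≤ (ballPointA1 a r).1 f :=
  ballPointA1_le_of_subset ((openBall_subset_closedBall b s).trans h) f

/-- A ball determines the corresponding point of the Berkovich line. -/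
theorem IsPointOf.unique {S : Set (Khat E)} {x y : BerkovichP1 (Khat E)} (hx : IsPointOf S x)
    (hy : IsPointOf S y) : x = y := by
  obtain ⟨a, r, hS, rfl⟩ := hx
  obtain ⟨b, s, hS', rfl⟩ := hy
  have key : ∀ {a : Khat E} {r : ℝ}, S = openBall a r ∨ S = closedBall a r →
      openBall a r ⊆ S ∧ S ⊆ closedBall a r := by
    rintro a r (rfl | rfl)
    · exact ⟨subset_rfl, openBall_subset_closedBall a r⟩
    · exact ⟨openBall_subset_closedBall a r, subset_rfl⟩
  refine congrArg _ (Subtype.ext (DFunLike.ext _ _ fun f => le_antisymm ?_ ?_))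
  · exact ballPointA1_le_of_subset ((key hS).1.trans (key hS').2) f
  · exact ballPointA1_le_of_subset ((key hS').1.trans (key hS).2) f

theorem isPointOf_closedBall (a : Khat E) (r : ℝ) :
    IsPointOf (closedBall a r) (ballPoint a r) := ⟨a, r, Or.inr rfl, rfl⟩

theorem isPointOf_openBall (a : Khat E) (r : ℝ) :
    IsPointOf (openBall a r) (ballPoint a r) := ⟨a, r, Or.inl rfl, rfl⟩

theorem tendsto_berkovichA1_iff {K : Type*} [NormedField K] {x : ℕ → BerkovichA1 K}
    {y : BerkovichA1 K} :
    Tendsto x atTop (𝓝 y) ↔ ∀ f : K[X], Tendsto (fun n => (x n).1 f) atTop (𝓝 (y.1 f)) := by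
  have h : IsInducing fun (x : BerkovichA1 K) (f : K[X]) => x.1 f := ⟨rfl⟩
  rw [h.tendsto_nhds_iff, tendsto_pi_nhds]
  rfl

theorem tendsto_coe_onePoint_iff {X : Type*} [TopologicalSpace X] {x : ℕ → X} {y : X} :
    Tendsto (fun n => (x n : OnePoint X)) atTop (𝓝 (y : OnePoint X)) ↔ Tendsto x atTop (𝓝 y) :=
  OnePoint.isOpenEmbedding_coe.isInducing.tendsto_nhds_iff.symm

theorem ballsTendTo_iff {S : ℕ → Set (Khat E)} {a : ℕ → Khat E} {r : ℕ → ℝ}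
    (h : ∀ n, IsPointOf (S n) (ballPoint (a n) (r n))) {y : BerkovichA1 (Khat E)} :
    BallsTendTo S (y : BerkovichP1 (Khat E)) ↔
      Tendsto (fun n => ballPointA1 (a n) (r n)) atTop (𝓝 y) := by
  rw [← tendsto_coe_onePoint_iff]
  constructor
  · rintro ⟨x, hx, hxy⟩
    exact hxy.congr fun n => (hx n).unique (h n)
  · exact fun hy => ⟨_, h, hy⟩

/-- On each polynomial the seminorms decrease and are bounded below by `0`; the axioms pass to the
pointwise limit. -/
theorem exists_tendsto_ballPointA1 {a : ℕ → Khat E} {r : ℕ → ℝ}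
    (h : Antitone fun n => closedBall (a n) (r n)) :
    ∃ y, Tendsto (fun n => ballPointA1 (a n) (r n)) atTop (𝓝 y) := by
  have hlim : ∀ f : (Khat E)[X], ∃ t,
      Tendsto (fun n => (ballPointA1 (a n) (r n)).1 f) atTop (𝓝 t) :=
    fun f => ⟨_, tendsto_atTop_ciInf
      (fun m n hmn => ballPointA1_le_of_closedBall_subset (h hmn) f)
      ⟨0, by rintro _ ⟨n, rfl⟩; exact apply_nonneg _ _⟩⟩
  choose y hy using hlim
  have hconst : ∀ {f : (Khat E)[X]} {t : ℝ}, (∀ n, (ballPointA1 (a n) (r n)).1 f = t) →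
      y f = t := fun {f t} h =>
    tendsto_nhds_unique (hy f) (tendsto_const_nhds.congr fun _ => (h _).symm)
  refine ⟨⟨{ toFun := y
             map_zero' := hconst fun n => map_zero _
             map_one' := hconst fun n => map_one _
             map_mul' := fun f g => tendsto_nhds_unique (hy _)
               (((hy f).mul (hy g)).congr fun n => (map_mul _ f g).symm)
             add_le' := fun f g => le_of_tendsto_of_tendsto' (hy _) ((hy f).add (hy g))
               fun n => map_add_le_add _ f g
             neg' := fun f => tendsto_nhds_unique (hy _)
               ((hy f).congr fun n => (map_neg_eq_map _ f).symm) },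
    fun c => hconst fun n => (ballPointA1 (a n) (r n)).2 c⟩, ?_⟩
  exact tendsto_berkovichA1_iff.2 hy

/-- The closed balls with centres `a n` and parameters `r n` decrease, have empty intersection
and converge to `y`. -/
structure NestTo (a : ℕ → Khat E) (r : ℕ → ℝ) (y : BerkovichA1 (Khat E)) : Prop where
  anti : Antitone fun n => closedBall (a n) (r n)
  empty : ⋂ n, closedBall (a n) (r n) = ∅
  lim : Tendsto (fun n => ballPointA1 (a n) (r n)) atTop (𝓝 y)

theorem isNest_and_ballsTendTo_iff {B : ℕ → Set (Khat E)} {y : BerkovichA1 (Khat E)} :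
    IsNest B ∧ BallsTendTo B (y : BerkovichP1 (Khat E)) ↔
      ∃ a r, B = (fun n => closedBall (a n) (r n)) ∧ NestTo a r y := by
  constructor
  · rintro ⟨⟨hB, hanti, hempty⟩, hy⟩
    choose a r hB using hB
    obtain rfl : B = _ := funext hB
    exact ⟨a, r, rfl, hanti, hempty, (ballsTendTo_iff fun n => isPointOf_closedBall _ _).1 hy⟩
  · rintro ⟨a, r, rfl, h⟩
    exact ⟨⟨fun n => ⟨_, _, rfl⟩, h.anti, h.empty⟩,
      (ballsTendTo_iff fun n => isPointOf_closedBall _ _).2 h.lim⟩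

theorem NestTo.isTypeIV {a : ℕ → Khat E} {r : ℕ → ℝ} {y : BerkovichA1 (Khat E)}
    (h : NestTo a r y) : IsTypeIV (y : BerkovichP1 (Khat E)) :=
  ⟨OnePoint.coe_ne_infty y, _, isNest_and_ballsTendTo_iff.2 ⟨a, r, rfl, h⟩⟩

theorem IsTypeIV.exists_nestTo {η : BerkovichP1 (Khat E)} (h : IsTypeIV η) :
    ∃ y : BerkovichA1 (Khat E), η = y ∧ ∃ a r, NestTo a r y := by
  obtain ⟨hη, B, hB⟩ := h
  obtain ⟨y, rfl⟩ := OnePoint.ne_infty_iff_exists.1 hη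
  obtain ⟨a, r, -, h⟩ := isNest_and_ballsTendTo_iff.1 hB
  exact ⟨y, rfl, a, r, h⟩

theorem liesIn_iff {y : BerkovichA1 (Khat E)} {S : Set (Khat E)} :
    LiesIn (y : BerkovichP1 (Khat E)) S ↔
      ∃ a r, NestTo a r y ∧ ∃ n, closedBall (a n) (r n) ⊆ S := by
  constructor
  · rintro ⟨B, hB, hBy, n, hn⟩
    obtain ⟨a, r, rfl, h⟩ := isNest_and_ballsTendTo_iff.1 ⟨hB, hBy⟩
    exact ⟨a, r, h, n, hn⟩
  · rintro ⟨a, r, h, n, hn⟩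
    obtain ⟨h1, h2⟩ := isNest_and_ballsTendTo_iff.2 ⟨a, r, rfl, h⟩
    exact ⟨_, h1, h2, n, hn⟩

/-! ### Type IV points measured by the values of `X - c` -/

namespace NestTo

variable {a : ℕ → Khat E} {r : ℕ → ℝ} {y : BerkovichA1 (Khat E)}

theorem exists_notMem (h : NestTo a r y) (c : Khat E) : ∃ n, c ∉ closedBall (a n) (r n) := by
  by_contra! hc
  have : c ∈ ⋂ n, closedBall (a n) (r n) := Set.mem_iInter.2 hc
  rwa [h.empty] at this

theorem le_parameter (h : NestTo a r y) {m n : ℕ} (hmn : m ≤ n) : r m ≤ r n :=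
  le_of_openBall_subset_closedBall ((openBall_subset_closedBall _ _).trans (h.anti hmn))

theorem tendsto_X_sub_C (h : NestTo a r y) (c : Khat E) :
    Tendsto (fun n => max ‖a n - c‖ (Real.exp (-r n))) atTop (𝓝 (y.1 (X - C c))) :=
  (tendsto_berkovichA1_iff.1 h.lim (X - C c)).congr fun _ => ballPointA1_X_sub_C _ _ _

/-- Once `c` is outside a ball of the nest, its distance to every point of that ball is the same. -/
theorem apply_X_sub_C (h : NestTo a r y) {c : Khat E} {N : ℕ}
    (hc : c ∉ closedBall (a N) (r N)) : y.1 (X - C c) = ‖a N - c‖ := by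
  refine tendsto_nhds_unique (h.tendsto_X_sub_C c) (tendsto_const_nhds.congr' ?_)
  filter_upwards [eventually_ge_atTop N] with n hn
  rw [mem_closedBall_iff, not_le, norm_sub_rev] at hc
  have h1 := mem_closedBall_iff.1 (h.anti hn (mem_closedBall_self (a n) (r n)))
  have h2 : ‖a n - c‖ = ‖a N - c‖ := by
    refine norm_eq_of_norm_sub_lt ?_
    rw [sub_sub_sub_cancel_right, norm_sub_rev]
    exact h1.trans_lt hc
  rw [h2, max_eq_left]
  exact (Real.exp_le_exp.2 (neg_le_neg (h.le_parameter hn))).trans hc.le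

/-- The right side involves only `y`, so lying in an open ball does not depend on the nest that
defines `y`. -/
theorem exists_subset_ball_iff (h : NestTo a r y) {c : Khat E} {ρ : ℝ} :
    (∃ n, closedBall (a n) (r n) ⊆ Metric.ball c ρ) ↔ y.1 (X - C c) < ρ := by
  constructor
  · rintro ⟨n, hn⟩
    obtain ⟨N, hN⟩ := h.exists_notMem c
    have hN' : c ∉ closedBall (a (max n N)) (r (max n N)) := fun hc =>
      hN (h.anti (le_max_right n N) hc)
    rw [h.apply_X_sub_C hN', ← mem_ball_iff_norm]
    exact hn (h.anti (le_max_left n N) (mem_closedBall_self _ _))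
  · intro hy
    obtain ⟨N, hN⟩ := h.exists_notMem c
    rw [h.apply_X_sub_C hN] at hy
    rw [mem_closedBall_iff, not_le, norm_sub_rev] at hN
    refine ⟨N, fun z hz => ?_⟩
    rw [mem_ball_iff_norm]
    exact norm_sub_lt_of_lt ((mem_closedBall_iff.1 hz).trans_lt (hN.trans hy)) hy

theorem apply_X_sub_C_pos (h : NestTo a r y) (c : Khat E) : 0 < y.1 (X - C c) := by
  obtain ⟨N, hN⟩ := h.exists_notMem c
  rw [h.apply_X_sub_C hN, norm_sub_rev]
  rw [mem_closedBall_iff, not_le] at hN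
  exact (Real.exp_pos _).trans hN

theorem exists_subset_ballOf (h : NestTo a r y) {l : List (Khat E)} (hl : IsExpr l)
    (hy : LiesIn (y : BerkovichP1 (Khat E)) (ballOf l)) :
    ∃ n, closedBall (a n) (r n) ⊆ ballOf l := by
  by_cases hl0 : l = []
  · exact ⟨0, by rw [hl0, ballOf_nil]; exact Set.subset_univ _⟩
  rw [ballOf_eq_ball hl0 hl] at hy ⊢
  obtain ⟨a', r', h', h2⟩ := liesIn_iff.1 hy
  exact h.exists_subset_ball_iff.2 (h'.exists_subset_ball_iff.1 h2)

/-- Two nests with empty intersection, one cofinal in the other, interlace, and monotonicity of the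
seminorms forces the same limit. -/
theorem tendsto_of_subset (h : NestTo a r y) {c : ℕ → Khat E} {s : ℕ → ℝ}
    (hanti : Antitone fun n => closedBall (c n) (s n))
    (hempty : ⋂ n, closedBall (c n) (s n) = ∅)
    (hsub : ∀ m, ∃ n, closedBall (a n) (r n) ⊆ closedBall (c m) (s m)) :
    Tendsto (fun n => ballPointA1 (c n) (s n)) atTop (𝓝 y) := by
  have hsub' : ∀ n, ∃ m, closedBall (c m) (s m) ⊆ closedBall (a n) (r n) := by
    intro n
    -- The two balls meet in a late centre `a (max n k)`; since `a n` is outside the `m`-th one, the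
    -- trichotomy leaves only the wanted inclusion.
    obtain ⟨m, hm⟩ : ∃ m, a n ∉ closedBall (c m) (s m) := by
      by_contra! hc
      have : a n ∈ ⋂ n, closedBall (c n) (s n) := Set.mem_iInter.2 hc
      rwa [hempty] at this
    obtain ⟨k, hk⟩ := hsub m
    have h1 : a (max n k) ∈ closedBall (c m) (s m) :=
      hk (h.anti (le_max_right n k) (mem_closedBall_self _ _))
    have h2 : a (max n k) ∈ closedBall (a n) (r n) :=
      h.anti (le_max_left n k) (mem_closedBall_self _ _)
    refine ⟨m, ?_⟩
    simp only [closedBall_eq_closedBall] at h1 h2 hm ⊢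
    rcases IsUltrametricDist.closedBall_subset_trichotomy (x := c m) (y := a n)
      (r := Real.exp (-s m)) (s := Real.exp (-r n)) with hh | hh | hh
    · exact hh
    · exact absurd (hh (Metric.mem_closedBall_self (Real.exp_pos _).le)) hm
    · exact absurd h2 (Set.disjoint_left.1 hh h1)
  refine tendsto_berkovichA1_iff.2 fun f => tendsto_order.2 ⟨fun t ht => ?_, fun t ht => ?_⟩
  · refine Eventually.of_forall fun m => ht.trans_le ?_
    obtain ⟨n, hn⟩ := hsub m
    refine le_of_tendsto (tendsto_berkovichA1_iff.1 h.lim f) ?_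
    filter_upwards [eventually_ge_atTop n] with k hk
    exact ballPointA1_le_of_closedBall_subset ((h.anti hk).trans hn) f
  · obtain ⟨n, hn⟩ := ((tendsto_berkovichA1_iff.1 h.lim f).eventually_lt_const ht).exists
    obtain ⟨m, hm⟩ := hsub' n
    filter_upwards [eventually_ge_atTop m] with k hk
    exact (ballPointA1_le_of_closedBall_subset ((hanti hk).trans hm) f).trans_lt hn

end NestTo

end BallPoints

/-! ### Infinite expressions with summable degrees -/

section Limits

variable {E : Type*} [Field E]

theorem ballOf_eq_openBall {l : List (Khat E)} (hl0 : l ≠ []) (hl : IsExpr l) :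
    ballOf l = openBall (eval l) (2 * (l.tail.map deg).sum) := by
  rw [ballOf_eq_ball hl0 hl, openBall_eq_ball, rad]

theorem sum_map_deg_tail_trunc (f : ℕ → Khat E) (n : ℕ) :
    ((trunc f n).tail.map deg).sum = ∑ i ∈ Finset.range n, deg (f (i + 1)) := by
  rw [trunc_eq_cons, List.tail_cons, List.map_map, sum_map_range]
  rfl

theorem IsInfExpr.ballOf_trunc {f : ℕ → Khat E} (hf : IsInfExpr f) (n : ℕ) :
    ballOf (trunc f n) =
      openBall (eval (trunc f n)) (2 * ∑ i ∈ Finset.range n, deg (f (i + 1))) := by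
  rw [ballOf_eq_openBall (trunc_ne_nil f n) (hf.isExpr_trunc n), sum_map_deg_tail_trunc]

theorem IsInfExpr.isPointOf_ballOf_trunc {f : ℕ → Khat E} (hf : IsInfExpr f) (n : ℕ) :
    IsPointOf (ballOf (trunc f n))
      (ballPoint (eval (trunc f n)) (2 * ∑ i ∈ Finset.range n, deg (f (i + 1)))) := by
  rw [hf.ballOf_trunc]
  exact isPointOf_openBall _ _

theorem antitone_ballOf_trunc (f : ℕ → Khat E) : Antitone fun n => ballOf (trunc f n) :=
  fun _ _ h => ballOf_anti (trunc_prefix_trunc f h)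

theorem IsInfExpr.iInter_ballOf_trunc {f : ℕ → Khat E} (hf : IsInfExpr f)
    (hs : Summable fun i => deg (f (i + 1))) : ⋂ n, ballOf (trunc f n) = ∅ := by
  refine Set.eq_empty_of_forall_notMem fun z hz => ?_
  obtain ⟨n, hn⟩ := hf.exists_notMem_cell
    (fun n => hs.sum_le_tsum (Finset.range n) fun i _ => (hf.2 _ i.succ_pos).le) z
  rw [← ballOf_eq_cell (trunc_ne_nil f n) (hf.isExpr_trunc n)] at hn
  exact hn (Set.mem_iInter.1 hz n)

/-- Type IV asks for closed balls. As degrees are positive the radii drop strictly, so closing each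
open ball and shifting by one changes neither nesting nor intersection. -/
theorem IsInfExpr.closedBall_succ_subset {f : ℕ → Khat E} (hf : IsInfExpr f) (n : ℕ) :
    closedBall (eval (trunc f (n + 1))) (2 * ∑ i ∈ Finset.range (n + 1), deg (f (i + 1))) ⊆
      ballOf (trunc f n) := by
  intro z hz
  have h1 : eval (trunc f (n + 1)) ∈ ballOf (trunc f n) := by
    refine antitone_ballOf_trunc f n.le_succ ?_
    change _ ∈ ballOf (trunc f (n + 1))
    rw [hf.ballOf_trunc]
    exact mem_openBall_self _ _
  rw [hf.ballOf_trunc, openBall_eq_ball, mem_ball_iff_norm] at h1 ⊢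
  refine norm_sub_lt_of_lt ((mem_closedBall_iff.1 hz).trans_lt (Real.exp_lt_exp.2 ?_)) h1
  rw [Finset.sum_range_succ]
  linarith [hf.2 _ n.succ_pos]

theorem IsInfExpr.antitone_closedBall {f : ℕ → Khat E} (hf : IsInfExpr f) :
    Antitone fun n =>
      closedBall (eval (trunc f n)) (2 * ∑ i ∈ Finset.range n, deg (f (i + 1))) := by
  refine antitone_nat_of_succ_le fun n => (hf.closedBall_succ_subset n).trans ?_
  rw [hf.ballOf_trunc]
  exact openBall_subset_closedBall _ _

theorem IsInfExpr.iInter_closedBall {f : ℕ → Khat E} (hf : IsInfExpr f)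
    (hs : Summable fun i => deg (f (i + 1))) :
    ⋂ n, closedBall (eval (trunc f n)) (2 * ∑ i ∈ Finset.range n, deg (f (i + 1))) = ∅ := by
  refine Set.subset_empty_iff.1 ((Set.subset_iInter fun n => ?_).trans
    (hf.iInter_ballOf_trunc hs).subset)
  exact (Set.iInter_subset _ (n + 1)).trans (hf.closedBall_succ_subset n)

theorem IsInfExpr.exists_nestTo {f : ℕ → Khat E} (hf : IsInfExpr f)
    (hs : Summable fun i => deg (f (i + 1))) :
    ∃ y, NestTo (fun n => eval (trunc f n))
      (fun n => 2 * ∑ i ∈ Finset.range n, deg (f (i + 1))) y := by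
  obtain ⟨y, hy⟩ := exists_tendsto_ballPointA1 hf.antitone_closedBall
  exact ⟨y, hf.antitone_closedBall, hf.iInter_closedBall hs, hy⟩

end Limits

/-! ### Points of type IVb: existence and the longest expression -/

section TypeIVb

open Polynomial

variable {E : Type*} [Field E]

variable (E) in
/-- The partial sums of `∑ t ^ (1 + 1 / (k + 1))`. -/
noncomputable def partialSum (n : ℕ) : Puiseux E :=
  ∑ k ∈ Finset.range n, monom E (-1 - 1 / ((k : ℚ) + 1))

theorem coeff_partialSum {k n : ℕ} (hk : k < n) :
    (partialSum E n : HahnSeries ℚ E).coeff (-1 - 1 / ((k : ℚ) + 1)) = 1 := by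
  have h : (partialSum E n : HahnSeries ℚ E) =
      ∑ k ∈ Finset.range n, HahnSeries.single (-1 - 1 / ((k : ℚ) + 1)) (1 : E) :=
    map_sum (puiseuxSubfield E).subtype _ _
  rw [h, HahnSeries.coeff_sum, Finset.sum_eq_single_of_mem k (Finset.mem_range.2 hk),
    HahnSeries.coeff_single_same]
  intro j _ hjk
  refine HahnSeries.coeff_single_of_ne fun hq => hjk ?_
  have h1 : (0 : ℚ) < (k : ℚ) + 1 := by positivity
  have h2 : (0 : ℚ) < (j : ℚ) + 1 := by positivity
  rw [sub_right_inj, div_eq_div_iff h1.ne' h2.ne'] at hq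
  have : (j : ℚ) = k := by linarith
  exact_mod_cast this

theorem not_forall_coeff_eq_one (x : Puiseux E) :
    ¬ ∀ k : ℕ, (x : HahnSeries ℚ E).coeff (-1 - 1 / ((k : ℚ) + 1)) = 1 := by
  intro h
  obtain ⟨N, y, hy⟩ := (mem_puiseuxSubfield E _).1 x.2
  -- The exponent with `k = N` has denominator `N + 1`, which is prime to `N`, so it is not in
  -- `(1/N)ℤ`.
  have hN := h (N : ℕ)
  rw [← hy] at hN
  refine one_ne_zero (hN.symm.trans (coeff_laurentEmb_of_ne E N y _ fun k hk => ?_))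
  have hNpos : (0 : ℚ) < ((N : ℕ) : ℚ) := by exact_mod_cast N.pos
  rw [div_eq_iff hNpos.ne'] at hk
  have h1 : ((N : ℕ) : ℚ) + 1 ≠ 0 := by positivity
  field_simp at hk
  have h2 : (k + N + 1 : ℤ) * ((N : ℕ) + 1 : ℤ) = 1 := by
    have : ((k : ℚ) + ((N : ℕ) : ℚ) + 1) * (((N : ℕ) : ℚ) + 1) = 1 := by linarith
    exact_mod_cast this
  have h3 := Int.eq_one_or_neg_one_of_mul_eq_one' h2
  have h4 : 0 < (N : ℕ) := N.pos
  omega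

variable (E) in
-- The `n`-th parameter is the exponent of the first omitted term. A common point would, up to an
-- error of norm below `1`, be a Puiseux series with all these exponents.
theorem exists_nestTo_partialSum :
    ∃ y, NestTo (fun n => (partialSum E n : Khat E)) (fun n => -1 - 1 / ((n : ℝ) + 1)) y := by
  have hanti : Antitone fun n : ℕ =>
      closedBall (partialSum E n : Khat E) (-1 - 1 / ((n : ℝ) + 1)) := by
    refine antitone_nat_of_succ_le fun n => closedBall_subset_closedBall ?_ ?_
    · refine sub_le_sub_left (one_div_le_one_div_of_le (by positivity) ?_) _
      push_cast
      linarith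
    · rw [mem_closedBall_iff, ← UniformSpace.Completion.coe_sub, UniformSpace.Completion.norm_coe,
        partialSum, Finset.sum_range_succ, partialSum, add_sub_cancel_left, norm_monom]
      push_cast
      exact le_rfl
  obtain ⟨y, hy⟩ := exists_tendsto_ballPointA1 hanti
  refine ⟨y, hanti, Set.eq_empty_of_forall_notMem fun z hz => ?_, hy⟩
  obtain ⟨x, hx⟩ := exists_puiseux_norm_sub_lt z one_pos
  refine not_forall_coeff_eq_one x fun k => ?_
  rw [← coeff_partialSum (E := E) k.lt_succ_self, ← sub_eq_zero, ← HahnSeries.coeff_sub]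
  -- Ball `k + 1` rather than `k`: its parameter strictly exceeds the exponent of term `k`, so that
  -- coefficient is fixed.
  have h1 : ‖(x : Khat E) - partialSum E (k + 1)‖ ≤
      Real.exp (-(-1 - 1 / (((k + 1 : ℕ) : ℝ) + 1))) := by
    refine norm_sub_le_of_le ?_ (mem_closedBall_iff.1 (Set.mem_iInter.1 hz (k + 1)))
    rw [norm_sub_rev]
    refine hx.le.trans (Real.one_le_exp ?_)
    rw [neg_sub, sub_neg_eq_add]
    positivity
  rw [← UniformSpace.Completion.coe_sub, UniformSpace.Completion.norm_coe, norm_puiseux] at h1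
  refine coeff_eq_zero_of_hahnAbs_le h1 ?_
  push_cast
  refine sub_lt_sub_left (one_div_lt_one_div_of_lt (by positivity) ?_) _
  linarith

theorem IsInfExpr.apply_X_sub_C_le_one {f : ℕ → Khat E} (hf : IsInfExpr f)
    {y : BerkovichA1 (Khat E)}
    (hy : BallsTendTo (fun n => ballOf (trunc f n)) (y : BerkovichP1 (Khat E))) :
    y.1 (X - C (f 0)) ≤ 1 := by
  have h := (ballsTendTo_iff hf.isPointOf_ballOf_trunc).1 hy
  refine le_of_tendsto' (tendsto_berkovichA1_iff.1 h _) fun n => ?_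
  rw [ballPointA1_X_sub_C]
  refine max_le ?_ ?_
  · have h1 := cell_subset_of_prefix (trunc_ne_nil f 0) (trunc_prefix_trunc f n.zero_le)
      (hf.isExpr_trunc n) (eval_mem_cell _)
    have h2 : trunc f 0 = [f 0] := rfl
    rw [h2, cell_cons _ (by simp), rad_nil, mem_ball_iff_norm] at h1
    exact h1.le
  · rw [Real.exp_le_one_iff, neg_nonpos]
    exact mul_nonneg two_pos.le (Finset.sum_nonneg fun i _ => (hf.2 _ i.succ_pos).le)

variable (E) in
theorem exists_isTypeIVb : ∃ η : BerkovichP1 (Khat E), IsTypeIVb η := by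
  obtain ⟨y, hy⟩ := exists_nestTo_partialSum E
  refine ⟨y, hy.isTypeIV, ?_⟩
  rintro ⟨-, f, hf, -, hfy⟩
  have h1 := hf.apply_X_sub_C_le_one hfy
  have h2 : Real.exp 1 ≤ y.1 (X - C (f 0)) := by
    refine ge_of_tendsto' (hy.tendsto_X_sub_C (f 0)) fun n =>
      le_max_of_le_right (Real.exp_le_exp.2 ?_)
    have : 0 ≤ 1 / ((n : ℝ) + 1) := by positivity
    linarith
  have h3 : 1 < Real.exp 1 := Real.one_lt_exp_iff.2 one_pos
  linarith

/-- The Möbius map of an expression identifies the closed balls inside `ballOf l` that avoid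
`eval l` with closed balls of possible tails. -/
theorem exists_closedBall_eq_preimage_phi {l : List (Khat E)} (hl : IsExpr l) {a : Khat E}
    {r : ℝ} (hsub : closedBall a r ⊆ ballOf l) (heval : eval l ∉ closedBall a r) :
    ∃ b s, closedBall b s = phi l ⁻¹' closedBall a r ∧
      (l ≠ [] → ∀ w ∈ closedBall b s, 1 < ‖w‖) := by
  cases l with
  | nil => exact ⟨a, r, rfl, fun h => absurd rfl h⟩
  | cons f m =>
    have hm : ∀ g ∈ m, 1 < ‖g‖ := fun g hg => ((isExpr_cons.1 hl).2 g hg).2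
    rw [ballOf_eq_cell (List.cons_ne_nil _ _) hl] at hsub
    have hR := rad_pos m
    -- Avoiding `eval l` rules out the empty tail.
    have hne : ∀ {w}, phi (f :: m) w ∈ closedBall a r → 1 < ‖w‖ := by
      intro w hw
      obtain ⟨w', hw', h⟩ := hsub hw
      obtain rfl := phi_injective _ h
      exact hw'.resolve_left fun h0 => heval (by rwa [h0, ← eval_eq_phi] at hw)
    obtain ⟨b, rfl⟩ := phi_surjective (f :: m) a
    have hb := hne (mem_closedBall_self _ r)
    have hb0 : 0 < ‖b‖ := one_pos.trans hb
    have h0 : ∀ {w}, 1 < ‖w‖ → ‖phi (f :: m) w - phi (f :: m) 0‖ = rad m / ‖w‖ := by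
      intro w hw
      rw [norm_phi_sub_phi f hm (Or.inr hw) zero_mem_tails, inv_zero, sub_zero, norm_inv,
        div_eq_mul_inv]
    have h1 : ∀ {w}, ‖w‖ = ‖b‖ →
        ‖phi (f :: m) w - phi (f :: m) b‖ = rad m / ‖b‖ ^ 2 * ‖w - b‖ := by
      intro w hw
      have hw0 : 0 < ‖w‖ := hw ▸ hb0
      rw [norm_phi_sub_phi f hm (Or.inr (hw ▸ hb)) (Or.inr hb),
        inv_sub_inv (norm_pos_iff.1 hw0) (norm_pos_iff.1 hb0), norm_div, norm_mul, hw,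
        norm_sub_rev b w]
      ring
    -- The radius is less than the distance to `eval l`, so all tails involved have norm `‖b‖`, and
    -- on them `phi` is a similarity of ratio `rad m / ‖b‖ ^ 2`.
    have hr : Real.exp (-r) < rad m / ‖b‖ := by
      rw [eval_eq_phi, mem_closedBall_iff, not_le, norm_sub_rev, h0 hb] at heval
      exact heval
    have hs : Real.exp (-(-Real.log (Real.exp (-r) / (rad m / ‖b‖ ^ 2)))) =
        Real.exp (-r) / (rad m / ‖b‖ ^ 2) := by
      rw [neg_neg, Real.exp_log (by positivity)]
    have heq : closedBall b (-Real.log (Real.exp (-r) / (rad m / ‖b‖ ^ 2))) =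
        phi (f :: m) ⁻¹' closedBall (phi (f :: m) b) r := by
      ext w
      rw [Set.mem_preimage, mem_closedBall_iff, hs, le_div_iff₀' (by positivity)]
      constructor
      · intro hw
        have hwb : ‖w‖ = ‖b‖ := by
          refine norm_eq_of_norm_sub_lt ?_
          have h2 := hw.trans_lt hr
          rw [div_mul_eq_mul_div, div_lt_div_iff₀ (by positivity) hb0, sq, mul_assoc,
            mul_lt_mul_iff_right₀ hR, mul_lt_mul_iff_left₀ hb0] at h2
          rwa [norm_sub_rev]
        rwa [mem_closedBall_iff, h1 hwb]
      · intro hw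
        have hw1 := hne hw
        have hwb : ‖w‖ = ‖b‖ := by
          have h3 : ‖phi (f :: m) w - phi (f :: m) 0‖ = ‖phi (f :: m) b - phi (f :: m) 0‖ := by
            refine norm_eq_of_norm_sub_lt ?_
            rw [sub_sub_sub_cancel_right, norm_sub_rev, h0 hb]
            exact (mem_closedBall_iff.1 hw).trans_lt hr
          rw [h0 hw1, h0 hb, div_eq_div_iff (one_pos.trans hw1).ne' hb0.ne'] at h3
          exact (mul_left_cancel₀ hR.ne' h3).symm
        rwa [mem_closedBall_iff, h1 hwb] at hw
    refine ⟨b, _, heq, fun _ w hw => ?_⟩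
    rw [heq] at hw
    exact hne hw

/-- The radius exceeds `1`, so replacing a tail by its polynomial part, or the reverse, stays in the
ball; as `0` is outside, its elements have norm above `1`. -/
theorem ballOfUndef_closedBall {l : List (Khat E)} (hl : IsExpr l) {b : Khat E} {s : ℝ}
    (hs : s < 0) (h0 : (0 : Khat E) ∉ closedBall b s) :
    ballOfUndef l (closedBall b s) = phi l '' closedBall b s := by
  have hexp : 1 < Real.exp (-s) := Real.one_lt_exp_iff.2 (neg_pos.2 hs)
  rw [mem_closedBall_iff, not_le, zero_sub, norm_neg] at h0
  ext z
  constructor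
  · rintro ⟨h, hD, hp, hdeg, hz⟩
    have hz' : z ∈ ballOf (l ++ [h]) := hz
    rw [ballOf_append_singleton
      (isExpr_append_singleton hl hp fun _ => deg_pos_iff.1 hdeg)] at hz'
    obtain ⟨w, hw, rfl⟩ := hz'
    refine ⟨w, ?_, rfl⟩
    rw [mem_closedBall_iff] at hD ⊢
    exact norm_sub_le_of_le ((mem_ball_iff_norm.1 hw).le.trans hexp.le) hD
  · rintro ⟨w, hw, rfl⟩
    obtain ⟨h, hp, hwh⟩ := exists_poly w
    rw [mem_closedBall_iff] at hw
    have hD : ‖h - b‖ ≤ Real.exp (-s) :=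
      norm_sub_le_of_le (norm_sub_rev w h ▸ hwh.le.trans hexp.le) hw
    have hh : 1 < ‖h‖ := by
      rw [norm_eq_of_norm_sub_lt (a := b) (b := h) (norm_sub_rev h b ▸ hD.trans_lt h0)]
      exact hexp.trans h0
    refine ⟨h, mem_closedBall_iff.2 hD, hp, deg_pos_iff.2 hh, ?_⟩
    change phi l w ∈ ballOf (l ++ [h])
    rw [ballOf_append_singleton (isExpr_append_singleton hl hp fun _ => hh)]
    exact ⟨w, mem_ball_iff_norm.2 hwh, rfl⟩

namespace NestTo

variable {a : ℕ → Khat E} {r : ℕ → ℝ} {y : BerkovichA1 (Khat E)}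

theorem prefix_or_prefix (h : NestTo a r y) {l m : List (Khat E)} (hl : IsExpr l)
    (hm : IsExpr m) (hyl : LiesIn (y : BerkovichP1 (Khat E)) (ballOf l))
    (hym : LiesIn (y : BerkovichP1 (Khat E)) (ballOf m)) : l <+: m ∨ m <+: l := by
  obtain ⟨i, hi⟩ := h.exists_subset_ballOf hl hyl
  obtain ⟨j, hj⟩ := h.exists_subset_ballOf hm hym
  exact prefix_or_prefix_of_mem_ballOf hl hm
    (hi (h.anti (le_max_left i j) (mem_closedBall_self _ _)))
    (hj (h.anti (le_max_right i j) (mem_closedBall_self _ _)))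

/-- Bounded degree sums give a nest converging to `y`. Otherwise the balls shrink to some `z` by
completeness, contradicting `apply_X_sub_C_pos`. -/
theorem isTypeIVa_of_forall_liesIn (h : NestTo a r y) {f : ℕ → Khat E} (hf : IsInfExpr f)
    (hy : ∀ n, LiesIn (y : BerkovichP1 (Khat E)) (ballOf (trunc f n))) :
    IsTypeIVa (y : BerkovichP1 (Khat E)) := by
  by_cases hC : ∃ C, ∀ n, ∑ i ∈ Finset.range n, deg (f (i + 1)) ≤ C
  · obtain ⟨C, hC⟩ := hC
    have hs : Summable fun i => deg (f (i + 1)) :=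
      summable_of_sum_range_le (fun i => (hf.2 _ i.succ_pos).le) hC
    refine ⟨h.isTypeIV, f, hf, hs, (ballsTendTo_iff hf.isPointOf_ballOf_trunc).2 ?_⟩
    refine h.tendsto_of_subset hf.antitone_closedBall (hf.iInter_closedBall hs) fun m => ?_
    obtain ⟨n, hn⟩ := h.exists_subset_ballOf (hf.isExpr_trunc m) (hy m)
    rw [hf.ballOf_trunc] at hn
    exact ⟨n, hn.trans (openBall_subset_closedBall _ _)⟩
  · push Not at hC
    have hrad := hf.tendsto_rad hC
    have hball : ∀ n, cell (trunc f n) = Metric.ball (eval (trunc f n)) (rad (trunc f n).tail) :=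
      fun n => cell_eq_ball (trunc_ne_nil f n) (hf.isExpr_trunc n)
    have hmem : ∀ {m n}, m ≤ n → eval (trunc f n) ∈ cell (trunc f m) := fun {m n} hmn =>
      cell_subset_of_prefix (trunc_ne_nil f m) (trunc_prefix_trunc f hmn) (hf.isExpr_trunc n)
        (eval_mem_cell _)
    have hcau : CauchySeq fun n => eval (trunc f n) := by
      refine cauchySeq_of_le_tendsto_0 _ (fun m n N hm hn => ?_) hrad
      have h1 := hmem hm
      have h2 := hmem hn
      rw [hball, mem_ball_iff_norm] at h1 h2
      rw [dist_eq_norm]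
      exact (norm_sub_lt_of_lt h1 (norm_sub_rev (eval (trunc f n)) _ ▸ h2)).le
    obtain ⟨z, hz⟩ := cauchySeq_tendsto_of_complete hcau
    have hzN : ∀ N, z ∈ cell (trunc f N) := by
      intro N
      have hcl : IsClosed (cell (trunc f N)) := by
        rw [hball]
        exact IsUltrametricDist.isClosed_ball _ _
      exact hcl.mem_of_tendsto hz (eventually_atTop.2 ⟨N, fun n hn => hmem hn⟩)
    have hle : y.1 (X - C z) ≤ 0 := by
      refine ge_of_tendsto' hrad fun N => ?_
      refine (h.exists_subset_ball_iff.1 ?_).le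
      have h1 := hzN N
      rw [hball] at h1
      rw [← IsUltrametricDist.ball_eq_of_mem h1, ← hball,
        ← ballOf_eq_cell (trunc_ne_nil f N) (hf.isExpr_trunc N)]
      exact h.exists_subset_ballOf (hf.isExpr_trunc N) (hy N)
    exact absurd (h.apply_X_sub_C_pos z) (not_lt.2 hle)

theorem exists_longest (h : NestTo a r y) (hy : ¬ IsTypeIVa (y : BerkovichP1 (Khat E))) :
    ∃ l : List (Khat E), IsExpr l ∧ LiesIn (y : BerkovichP1 (Khat E)) (ballOf l) ∧
      ∀ l' : List (Khat E), IsExpr l' → LiesIn (y : BerkovichP1 (Khat E)) (ballOf l') →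
        l' <+: l := by
  by_contra! hno
  obtain ⟨f, hf⟩ := exists_seq_of_forall_exists_append
    (P := fun l => IsExpr l ∧ LiesIn (y : BerkovichP1 (Khat E)) (ballOf l))
    ⟨IsExpr.nil, liesIn_iff.2 ⟨a, r, h, 0, by rw [ballOf_nil]; exact Set.subset_univ _⟩⟩ (by
      rintro l ⟨hl, hyl⟩
      obtain ⟨l', hl', hyl', hnp⟩ := hno l hl hyl
      obtain ⟨m, rfl⟩ := (h.prefix_or_prefix hl hl' hyl hyl').resolve_right hnp
      cases m with
      | nil => simp at hnp
      | cons g m =>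
        have hp : l ++ [g] <+: l ++ g :: m := ⟨m, by simp⟩
        refine ⟨g, hl'.of_prefix hp, ?_⟩
        obtain ⟨a', r', h', n, hn⟩ := liesIn_iff.1 hyl'
        exact liesIn_iff.2 ⟨a', r', h', n, hn.trans (ballOf_anti hp)⟩)
  exact hy (h.isTypeIVa_of_forall_liesIn (isInfExpr_of_isExpr_trunc fun n => (hf _).1)
    fun n => (hf _).2)

theorem exists_closedBall_ballOfUndef (h : NestTo a r y) {l : List (Khat E)} (hl : IsExpr l)
    (hyl : LiesIn (y : BerkovichP1 (Khat E)) (ballOf l))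
    (hmax : ∀ l' : List (Khat E), IsExpr l' → LiesIn (y : BerkovichP1 (Khat E)) (ballOf l') →
      l' <+: l) :
    ∃ (b : ℕ → Khat E) (s : ℕ → ℝ), (∀ n, s n < 0) ∧
      Antitone (fun n => closedBall (b n) (s n)) ∧ ⋂ n, closedBall (b n) (s n) = ∅ ∧
      BallsTendTo (fun n => ballOfUndef l (closedBall (b n) (s n)))
        (y : BerkovichP1 (Khat E)) := by
  obtain ⟨i, hi⟩ := h.exists_subset_ballOf hl hyl
  obtain ⟨j, hj⟩ := h.exists_notMem (eval l)
  -- From `N` on, the balls lie in `ballOf l` and avoid `eval l`, so they pull back to closed balls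
  -- of tails.
  let N := max i j
  have hsub : ∀ n, closedBall (a (n + N)) (r (n + N)) ⊆ ballOf l := fun n =>
    (h.anti ((le_max_left i j).trans (Nat.le_add_left N n))).trans hi
  have heval : ∀ n, eval l ∉ closedBall (a (n + N)) (r (n + N)) := fun n hn =>
    hj (h.anti ((le_max_right i j).trans (Nat.le_add_left N n)) hn)
  choose b s hbs hpos using fun n => exists_closedBall_eq_preimage_phi hl (hsub n) (heval n)
  have hanti : Antitone fun n => closedBall (b n) (s n) := by
    intro m n hmn
    simp only [hbs]
    exact Set.preimage_mono (h.anti (Nat.add_le_add_right hmn N))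
  have hnotMem : ∀ w, ∃ n, w ∉ closedBall (b n) (s n) := by
    intro w
    obtain ⟨n, hn⟩ := h.exists_notMem (phi l w)
    refine ⟨n, fun hw => hn ?_⟩
    rw [hbs] at hw
    exact h.anti (Nat.le_add_right n N) hw
  have hs : ∀ n, s n < 0 := by
    intro n
    by_contra! hsn
    -- A later ball omits `b n`, hence has radius strictly below `1`. Its elements then share a
    -- polynomial part `p`, and `l ++ [p]` contradicts maximality.
    obtain ⟨k, hk⟩ := hnotMem (b n)
    let m := max n k
    have hbm : b n ∉ closedBall (b m) (s m) := fun hb => hk (hanti (le_max_right n k) hb)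
    have hlt : Real.exp (-s m) < 1 := by
      rw [mem_closedBall_iff, not_le] at hbm
      have h1 := mem_closedBall_iff.1 (hanti (le_max_left n k) (mem_closedBall_self (b m) (s m)))
      rw [norm_sub_rev] at h1
      exact hbm.trans_le (h1.trans (Real.exp_le_one_iff.2 (neg_nonpos.2 hsn)))
    obtain ⟨p, hp, hbp⟩ := exists_poly (b m)
    have hlp : IsExpr (l ++ [p]) := isExpr_append_singleton hl hp fun hl0 => by
      have h1 := hpos m hl0 (b m) (mem_closedBall_self _ _)
      rwa [norm_eq_of_norm_sub_lt (hbp.trans h1)]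
    have hle := (hmax _ hlp (liesIn_iff.2 ⟨a, r, h, m + N, fun z hz => ?_⟩)).length_le
    · simp at hle
    · obtain ⟨w, rfl⟩ := phi_surjective l z
      have hw : w ∈ closedBall (b m) (s m) := by rwa [hbs]
      rw [ballOf_append_singleton hlp]
      exact ⟨w, mem_ball_iff_norm.2
        (norm_sub_lt_of_lt ((mem_closedBall_iff.1 hw).trans_lt hlt) hbp), rfl⟩
  have hundef : ∀ n, ballOfUndef l (closedBall (b n) (s n)) =
      closedBall (a (n + N)) (r (n + N)) := by
    intro n
    rw [ballOfUndef_closedBall hl (hs n), hbs, Set.image_preimage_eq _ (phi_surjective l)]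
    rw [hbs, Set.mem_preimage, ← eval_eq_phi]
    exact heval n
  refine ⟨b, s, hs, hanti, Set.eq_empty_of_forall_notMem fun w hw => ?_, ?_⟩
  · obtain ⟨n, hn⟩ := hnotMem w
    exact hn (Set.mem_iInter.1 hw n)
  · simp only [hundef]
    exact (ballsTendTo_iff fun n => isPointOf_closedBall _ _).2
      (h.lim.comp (tendsto_add_atTop_nat N))

end NestTo

end TypeIVb

end PuiseuxCF

theorem mainTheorem4 (E : Type*) [Field E] :
    -- the elements whose continued fraction starts with a given `f₀, …, fₙ` form a ball
    (∀ l : List (PuiseuxCF.Khat E), l ≠ [] → PuiseuxCF.IsExpr l →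
      PuiseuxCF.ballOf l =
        PuiseuxCF.openBall (PuiseuxCF.eval l) (2 * (l.tail.map PuiseuxCF.deg).sum)) ∧
    -- nested balls with empty intersection, hence a point of type IV
    (∀ f : ℕ → PuiseuxCF.Khat E, PuiseuxCF.IsInfExpr f →
      Summable (fun i => PuiseuxCF.deg (f (i + 1))) →
      Antitone (fun n => PuiseuxCF.ballOf (PuiseuxCF.trunc f n)) ∧
      ⋂ n, PuiseuxCF.ballOf (PuiseuxCF.trunc f n) = ∅ ∧
      ∃ η, PuiseuxCF.IsTypeIV η ∧
        PuiseuxCF.BallsTendTo (fun n => PuiseuxCF.ballOf (PuiseuxCF.trunc f n)) η) ∧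
    -- not every point of type IV arises in this way
    (∃ η : PuiseuxCF.BerkovichP1 (PuiseuxCF.Khat E), PuiseuxCF.IsTypeIVb η) ∧
    -- finite continued fractions with an undefined last coefficient
    (∀ η : PuiseuxCF.BerkovichP1 (PuiseuxCF.Khat E), PuiseuxCF.IsTypeIVb η →
      ∃ l : List (PuiseuxCF.Khat E), PuiseuxCF.IsExpr l ∧
        PuiseuxCF.LiesIn η (PuiseuxCF.ballOf l) ∧
        (∀ l' : List (PuiseuxCF.Khat E), PuiseuxCF.IsExpr l' →
          PuiseuxCF.LiesIn η (PuiseuxCF.ballOf l') → l' <+: l) ∧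
        ∃ (a : ℕ → PuiseuxCF.Khat E) (r : ℕ → ℝ), (∀ n, r n < 0) ∧
          Antitone (fun n => PuiseuxCF.closedBall (a n) (r n)) ∧
          ⋂ n, PuiseuxCF.closedBall (a n) (r n) = ∅ ∧
          PuiseuxCF.BallsTendTo
            (fun n => PuiseuxCF.ballOfUndef l (PuiseuxCF.closedBall (a n) (r n))) η) := by
  refine ⟨fun l hl0 hl => PuiseuxCF.ballOf_eq_openBall hl0 hl, fun f hf hs => ?_,
    PuiseuxCF.exists_isTypeIVb E, fun η hη => ?_⟩
  · obtain ⟨y, hy⟩ := hf.exists_nestTo hs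
    exact ⟨PuiseuxCF.antitone_ballOf_trunc f, hf.iInter_ballOf_trunc hs, y, hy.isTypeIV,
      (PuiseuxCF.ballsTendTo_iff hf.isPointOf_ballOf_trunc).2 hy.lim⟩
  · obtain ⟨y, rfl, a, r, h⟩ := hη.1.exists_nestTo
    obtain ⟨l, hl, hyl, hmax⟩ := h.exists_longest hη.2
    exact ⟨l, hl, hyl, hmax, h.exists_closedBall_ballOfUndef hl hyl hmax⟩
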